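/- **Functionals.** A functional of rank $(k,l)$ is a map $F:(\mathbb N^{\mathbb N})^k\times\mathbb N^l\to\mathbb N$. Write $|x|$ for the length of the binary representation of $x$ ($|0|=0$), $x\#y=2^{|x|\cdot|y|}$, and $x{\restriction}y=\lfloor x/2^{|x|\dot- y}\rfloor$ for the number formed by the $y$ most significant bits of $x$. The class of *basic feasible functionals* is the least class of functionals that contains $o(x)=0$, $s_0(x)=2x$, $s_1(x)=2x+1$, the projections $i^n_k(x_1,\dots,x_n)=x_k$, $x\#y$ and $Ap(f,x)=f(x)$, and is closed under * expansion: $F(\vec f,\vec x)=G(f_{\rho(1)},\dots,f_{\rho(k)},x_{\sigma(1)},\dots,x_{\sigma(l)})$, where $f_{\rho(i)}$, $x_{\sigma(i)}$ are any entries of the (possibly longer) argument lists $\vec f$, $\vec x$ (so dummy arguments may be added); * functional composition: $F(\vec f,\vec x)=H(\vec f,G_1(\vec f,\vec x),\dots,G_m(\vec f,\vec x),\vec x)$; * limited recursion on notation: from $G,H_1,H_2,K$ to any $F$ such that, for all arguments, $F(\vec f,\vec x,0)=G(\vec f,\vec x)$, $F(\vec f,\vec x,2y)=H_1(\vec f,\vec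 x,y,F(\vec f,\vec x,y))$ if $y>0$, $F(\vec f,\vec x,2y+1)=H_2(\vec f,\vec x,y,F(\vec f,\vec x,y))$, and $|F(\vec f,\vec x,y)|\le|K(\vec f,\vec x,y)|$. **The theory.** Consider the two-sorted first-order language with variables for numbers and variables for functions $\mathbb N\to\mathbb N$, and with the symbols $\le,0,1,+,\cdot,|x|,\lfloor x/2\rfloor,\#,\restriction$ and $Ap(f,x)$ (besides equality of numbers). Bounded quantifiers are $\exists x\le t$, $\forall x\le t$ with $x$ a number variable that does not occur in the term $t$; they are sharply bounded if $t$ is of the form $|s|$. The classes $\Sigma^b_1$ and $\Pi^b_1$ are the least classes of formulas that both contain the atomic formulas, are both closed under $\wedge$, $\vee$ and sharply bounded quantification, are such that a negation $\neg A$ is in one if $A$ is in the other and $A\to B$ is in one if $B$ is in it and $A$ in the other, and of which $\Sigma^b_1$ is closed under $\exists x\le t$ and $\Pi^b_1$ under $\forall x\le t$. The theory $S^1_2$ consists of the axioms $BASIC$, i.e. Buss's 32 open axioms of bounded arithmetic (with $x+1$ for the successor of $x$) together with $$x{\restriction}0=0,\quad x\ge1\to x{\restriction}1=1,\quad y<|x|\to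 x{\restriction}y=\lfloor\tfrac12(x{\restriction}(y+1))\rfloor,\quad y\ge|x|\to x{\restriction}y=x,$$ and of the scheme $\Sigma^b_1$-PIND $$A(0)\wedge\forall x\,(A(\lfloor x/2\rfloor)\to A(x))\to\forall x\,A(x)$$ for all $\Sigma^b_1$ formulas $A$, which may have further number and function variables as parameters. **Definability.** A functional $F$ of rank $(k,l)$ is *$\Sigma^b_1$-definable in $S^1_2$* if there are a $\Sigma^b_1$ formula $\Psi(\vec f,\vec x,y)$ and terms $t_1(\vec f,\vec x)$, $t_2(\vec f,\vec x,z_1)$, …, $t_p(\vec f,\vec x,z_1,\dots,z_{p-1})$, $t(\vec f,\vec x,z_1,\dots,z_p)$, for some $p\ge 0$, such that $$S^1_2\vdash\forall\vec f\,\forall\vec x\,\exists z_1\le t_1\cdots\exists z_p\le t_p\,\exists y\le t\;\Psi(\vec f,\vec x,y),\qquad S^1_2\vdash\forall\vec f\,\forall\vec x\,\exists!y\,\Psi(\vec f,\vec x,y),$$ and $\Psi(\vec f,\vec x,F(\vec f,\vec x))$ is true in the standard model for all $\vec f\in(\mathbb N^{\mathbb N})^k$ and $\vec x\in\mathbb N^l$.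 **Theorem 3.** Every basic feasible functional is $\Sigma^b_1$-definable in $S^1_2$. -/

import Mathlib

namespace BFF

/-! ### Basic feasible functionals -/

/-- Type 2 functionals of rank `(k, l)`, i.e. maps `(ℕ → ℕ)^k × ℕ^l → ℕ`. -/
abbrev Functional (k l : ℕ) : Type := (Fin k → ℕ → ℕ) → (Fin l → ℕ) → ℕ

/-- `x # y = 2 ^ (|x| * |y|)`, where `|x| = Nat.size x` is the length of the binary
representation of `x` (and `|0| = 0`). -/
def smashNat (x y : ℕ) : ℕ := 2 ^ (Nat.size x * Nat.size y)

/-- The number formed by the `y` most significant bits of `x`. -/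
def mspNat (x y : ℕ) : ℕ := x / 2 ^ (Nat.size x - y)

/-- The class of basic feasible functionals: the least class of functionals that contains the
initial functions and the application functional and is closed under expansion, functional
composition and limited recursion on notation. -/
inductive IsBasicFeasible : {k l : ℕ} → Functional k l → Prop
  /-- `o(x) = 0` -/
  | zero : IsBasicFeasible (k := 0) (l := 1) fun _ _ => 0
  /-- `s₀(x) = 2x` -/
  | bit0 : IsBasicFeasible (k := 0) (l := 1) fun _ x => 2 * x 0
  /-- `s₁(x) = 2x + 1` -/
  | bit1 : IsBasicFeasible (k := 0) (l := 1) fun _ x => 2 * x 0 + 1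
  /-- the projections -/
  | proj {n : ℕ} (i : Fin n) : IsBasicFeasible (k := 0) (l := n) fun _ x => x i
  /-- `x # y` -/
  | smash : IsBasicFeasible (k := 0) (l := 2) fun _ x => smashNat (x 0) (x 1)
  /-- `Ap(f, x) = f(x)` -/
  | app : IsBasicFeasible (k := 1) (l := 1) fun f x => f 0 (x 0)
  /-- Expansion: the arguments of `G` are taken from a longer list of arguments, in any order.
  (Appending dummy arguments `g⃗`, `y⃗` at the end is the case `ρ = Fin.castAdd _`,
  `σ = Fin.castAdd _`.) -/
  | expand {k l k' l' : ℕ} (ρ : Fin k → Fin k') (σ : Fin l → Fin l') {G : Functional k l} :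
      IsBasicFeasible G →
      IsBasicFeasible (k := k') (l := l') fun f x => G (fun i => f (ρ i)) (fun i => x (σ i))
  /-- Functional composition: `F(f⃗, x⃗) = H(f⃗, G₁(f⃗, x⃗), …, G_m(f⃗, x⃗), x⃗)`. -/
  | comp {k l m : ℕ} {H : Functional k (m + l)} {G : Fin m → Functional k l} :
      IsBasicFeasible H → (∀ j, IsBasicFeasible (G j)) →
      IsBasicFeasible (k := k) (l := l) fun f x => H f (Fin.append (fun j => G j f x) x)
  /-- Limited recursion on notation; the arguments are listed as `x⃗, y` (for `F` and `K`) and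
  `x⃗, y, F(f⃗, x⃗, y)` (for `H₁` and `H₂`). -/
  | limRec {k l : ℕ} {G : Functional k l} {H₁ H₂ : Functional k (l + 2)}
      {K F : Functional k (l + 1)} :
      IsBasicFeasible G → IsBasicFeasible H₁ → IsBasicFeasible H₂ → IsBasicFeasible K →
      (∀ f x, F f (Fin.snoc x 0) = G f x) →
      (∀ f x y, 0 < y →
        F f (Fin.snoc x (2 * y)) = H₁ f (Fin.snoc (Fin.snoc x y) (F f (Fin.snoc x y)))) →
      (∀ f x y,
        F f (Fin.snoc x (2 * y + 1)) = H₂ f (Fin.snoc (Fin.snoc x y) (F f (Fin.snoc x y)))) →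
      (∀ f x y, Nat.size (F f (Fin.snoc x y)) ≤ Nat.size (K f (Fin.snoc x y))) →
      IsBasicFeasible F

/-! ### The two-sorted language

One sort of variables ranges over numbers, the other over functions from numbers to numbers.
Each sort has its own de Bruijn indices. The only terms of function sort are variables. -/

/-- Terms of number sort. -/
inductive Tm : Type
  | var (i : ℕ)
  | zero
  | one
  | add (s t : Tm)
  | mul (s t : Tm)
  /-- the length `|t|` -/
  | len (t : Tm)
  /-- `⌊t / 2⌋` -/
  | half (t : Tm)
  /-- `s # t` -/
  | smash (s t : Tm)
  /-- the `t` most significant bits of `s` -/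
  | msp (s t : Tm)
  /-- `Ap(f_j, t)`, the value at `t` of the `j`-th function variable -/
  | ap (j : ℕ) (t : Tm)

instance : Zero Tm := ⟨Tm.zero⟩
instance : One Tm := ⟨Tm.one⟩
instance : Add Tm := ⟨Tm.add⟩
instance : Mul Tm := ⟨Tm.mul⟩

/-- Formulas. The logic is classical, with the connectives `⊥` and `→`, the universal quantifier
over numbers and the universal quantifier over functions as primitives. -/
inductive Fm : Type
  | bot
  | eq (s t : Tm)
  | le (s t : Tm)
  | imp (φ ψ : Fm)
  /-- quantification over numbers -/
  | all (φ : Fm)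
  /-- quantification over functions -/
  | allFn (φ : Fm)

namespace Tm

/-- Replace function variables according to `ρ` and number variables according to `σ`. -/
def subst (ρ : ℕ → ℕ) (σ : ℕ → Tm) : Tm → Tm
  | var i => σ i
  | zero => zero
  | one => one
  | add s t => add (s.subst ρ σ) (t.subst ρ σ)
  | mul s t => mul (s.subst ρ σ) (t.subst ρ σ)
  | len t => len (t.subst ρ σ)
  | half t => half (t.subst ρ σ)
  | smash s t => smash (s.subst ρ σ) (t.subst ρ σ)
  | msp s t => msp (s.subst ρ σ) (t.subst ρ σ)
  | ap j t => ap (ρ j) (t.subst ρ σ)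

/-- Increase all indices of number variables by one. -/
def shift (t : Tm) : Tm := t.subst id fun i => var (i + 1)

/-- Increase all indices of function variables by one. -/
def shiftFn (t : Tm) : Tm := t.subst Nat.succ var

/-- The value of a term in the standard model. -/
def eval (f : ℕ → ℕ → ℕ) (v : ℕ → ℕ) : Tm → ℕ
  | var i => v i
  | zero => 0
  | one => 1
  | add s t => s.eval f v + t.eval f v
  | mul s t => s.eval f v * t.eval f v
  | len t => Nat.size (t.eval f v)
  | half t => t.eval f v / 2
  | smash s t => smashNat (s.eval f v) (t.eval f v)
  | msp s t => mspNat (s.eval f v) (t.eval f v)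
  | ap j t => f j (t.eval f v)

/-- All function variables have index `< k` and all number variables have index `< n`. -/
def Scoped (k n : ℕ) : Tm → Prop
  | var i => i < n
  | zero => True
  | one => True
  | add s t => s.Scoped k n ∧ t.Scoped k n
  | mul s t => s.Scoped k n ∧ t.Scoped k n
  | len t => t.Scoped k n
  | half t => t.Scoped k n
  | smash s t => s.Scoped k n ∧ t.Scoped k n
  | msp s t => s.Scoped k n ∧ t.Scoped k n
  | ap j t => j < k ∧ t.Scoped k n

end Tm

/-- Put `a` in front of the sequence `v`. -/
def cons {α : Type} (a : α) (v : ℕ → α) : ℕ → α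
  | 0 => a
  | i + 1 => v i

namespace Fm

/-- Simultaneous capture-avoiding substitution for the free variables: function variables
according to `ρ`, number variables according to `σ`. -/
def subst : (ℕ → ℕ) → (ℕ → Tm) → Fm → Fm
  | _, _, bot => bot
  | ρ, σ, eq s t => eq (s.subst ρ σ) (t.subst ρ σ)
  | ρ, σ, le s t => le (s.subst ρ σ) (t.subst ρ σ)
  | ρ, σ, imp φ ψ => imp (φ.subst ρ σ) (ψ.subst ρ σ)
  | ρ, σ, all φ => all (φ.subst ρ (cons (Tm.var 0) fun i => (σ i).shift))
  | ρ, σ, allFn φ => allFn (φ.subst (cons 0 fun j => ρ j + 1) fun i => (σ i).shiftFn)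

/-- Increase the indices of all free number variables by one. -/
def shift (φ : Fm) : Fm := φ.subst id fun i => Tm.var (i + 1)

/-- Increase the indices of all free function variables by one. -/
def shiftFn (φ : Fm) : Fm := φ.subst Nat.succ Tm.var

/-- The instance `φ(t)` of `∀ x, φ(x)`. -/
def inst (φ : Fm) (t : Tm) : Fm := φ.subst id (cons t Tm.var)

/-- The instance `φ(f_j)` of `∀ f, φ(f)`. -/
def instFn (φ : Fm) (j : ℕ) : Fm := φ.subst (cons j id) Tm.var

def neg (φ : Fm) : Fm := imp φ bot
def and (φ ψ : Fm) : Fm := neg (imp φ (neg ψ))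
def or (φ ψ : Fm) : Fm := imp (neg φ) ψ
def iff (φ ψ : Fm) : Fm := and (imp φ ψ) (imp ψ φ)
def ex (φ : Fm) : Fm := neg (all (neg φ))

/-- `∀ x ≤ t, φ(x)`, where `x` does not occur in `t`. -/
def ball (t : Tm) (φ : Fm) : Fm := all (imp (le (Tm.var 0) t.shift) φ)

/-- `∃ x ≤ t, φ(x)`, where `x` does not occur in `t`. -/
def bex (t : Tm) (φ : Fm) : Fm := neg (ball t (neg φ))

/-- `∃! x, φ(x)`, i.e. `∃ x, φ(x) ∧ ∀ z, φ(z) → z = x`. -/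
def exUnique (φ : Fm) : Fm :=
  ex (and φ (all (imp (φ.subst id (cons (Tm.var 0) fun i => Tm.var (i + 2)))
    (eq (Tm.var 0) (Tm.var 1)))))

/-- `l` universal quantifiers over numbers. -/
def alls : ℕ → Fm → Fm
  | 0, φ => φ
  | l + 1, φ => all (alls l φ)

/-- `k` universal quantifiers over functions. -/
def allFns : ℕ → Fm → Fm
  | 0, φ => φ
  | k + 1, φ => allFn (allFns k φ)

/-- The quantifier prefix `∃ z₁ ≤ t₁, …, ∃ z_p ≤ t_p`, where `t_i` may contain
`z₁, …, z_{i-1}`. -/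
def bexs : List Tm → Fm → Fm
  | [], φ => φ
  | t :: ts, φ => bex t (bexs ts φ)

/-- Truth in the standard model, where number variables range over `ℕ` and function variables
over all functions `ℕ → ℕ`. -/
def Holds : (ℕ → ℕ → ℕ) → (ℕ → ℕ) → Fm → Prop
  | _, _, bot => False
  | f, v, eq s t => s.eval f v = t.eval f v
  | f, v, le s t => s.eval f v ≤ t.eval f v
  | f, v, imp φ ψ => φ.Holds f v → ψ.Holds f v
  | f, v, all φ => ∀ a : ℕ, φ.Holds f (cons a v)
  | f, v, allFn φ => ∀ g : ℕ → ℕ, φ.Holds (cons g f) v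

/-- All free function variables have index `< k` and all free number variables have
index `< n`. -/
def Scoped : ℕ → ℕ → Fm → Prop
  | _, _, bot => True
  | k, n, eq s t => s.Scoped k n ∧ t.Scoped k n
  | k, n, le s t => s.Scoped k n ∧ t.Scoped k n
  | k, n, imp φ ψ => φ.Scoped k n ∧ ψ.Scoped k n
  | k, n, all φ => φ.Scoped k (n + 1)
  | k, n, allFn φ => φ.Scoped (k + 1) n

end Fm

/-! ### The classes `Σ^b_1` and `Π^b_1` -/

/-- `IsB1 true` is the class `Σ^b_1` and `IsB1 false` is the class `Π^b_1`: both contain the atomic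
formulas and are closed under sharply bounded quantification; an implication is in a class if its
conclusion is in that class and its premise in the dual one; `Π^b_1` is closed under bounded
universal quantification. Closure of both classes under `∧`, `∨`, sharply bounded existential
quantification, and of `Σ^b_1` under bounded existential quantification, follows
(see the lemmas below). -/
inductive IsB1 : Bool → Fm → Prop
  | bot (b : Bool) : IsB1 b Fm.bot
  | eq (b : Bool) (s t : Tm) : IsB1 b (Fm.eq s t)
  | le (b : Bool) (s t : Tm) : IsB1 b (Fm.le s t)
  | imp {b : Bool} {φ ψ : Fm} : IsB1 (!b) φ → IsB1 b ψ → IsB1 b (Fm.imp φ ψ)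
  | sball {b : Bool} (t : Tm) {φ : Fm} : IsB1 b φ → IsB1 b (Fm.ball (Tm.len t) φ)
  | ball (t : Tm) {φ : Fm} : IsB1 false φ → IsB1 false (Fm.ball t φ)

/-- `Σ^b_1` formulas. -/
def IsSigmaB1 (φ : Fm) : Prop := IsB1 true φ

theorem IsB1.neg {b : Bool} {φ : Fm} (h : IsB1 (!b) φ) : IsB1 b φ.neg := .imp h (.bot b)

theorem IsB1.and {b : Bool} {φ ψ : Fm} (h : IsB1 b φ) (h' : IsB1 b ψ) : IsB1 b (φ.and ψ) :=
  .neg (.imp (by simpa using h) (.neg (by simpa using h')))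

theorem IsB1.or {b : Bool} {φ ψ : Fm} (h : IsB1 b φ) (h' : IsB1 b ψ) : IsB1 b (φ.or ψ) :=
  .imp (.neg (by simpa using h)) h'

theorem IsB1.sbex {b : Bool} (t : Tm) {φ : Fm} (h : IsB1 b φ) :
    IsB1 b (Fm.bex (Tm.len t) φ) :=
  .neg (.sball t (.neg (by simpa using h)))

theorem IsB1.bex (t : Tm) {φ : Fm} (h : IsB1 true φ) : IsB1 true (Fm.bex t φ) :=
  .neg (.ball t (.neg h))

/-! ### Derivability -/

/-- Natural deduction for classical two-sorted first-order logic with equality: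
`Derives T Γ φ` says that `φ` is derivable from the hypotheses `Γ` and the axioms `T`. Free
variables of the axioms in `T` (but not of those in `Γ`) count as universally quantified. -/
inductive Derives (T : Set Fm) : List Fm → Fm → Prop
  | ax {Γ : List Fm} {φ : Fm} : φ ∈ T → Derives T Γ φ
  | hyp {Γ : List Fm} {φ : Fm} : φ ∈ Γ → Derives T Γ φ
  | impI {Γ : List Fm} {φ ψ : Fm} : Derives T (φ :: Γ) ψ → Derives T Γ (φ.imp ψ)
  | impE {Γ : List Fm} {φ ψ : Fm} : Derives T Γ (φ.imp ψ) → Derives T Γ φ → Derives T Γ ψ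
  | contra {Γ : List Fm} {φ : Fm} : Derives T (φ.neg :: Γ) Fm.bot → Derives T Γ φ
  | allI {Γ : List Fm} {φ : Fm} : Derives T (Γ.map Fm.shift) φ → Derives T Γ φ.all
  | allE {Γ : List Fm} {φ : Fm} (t : Tm) : Derives T Γ φ.all → Derives T Γ (φ.inst t)
  | allFnI {Γ : List Fm} {φ : Fm} : Derives T (Γ.map Fm.shiftFn) φ → Derives T Γ φ.allFn
  | allFnE {Γ : List Fm} {φ : Fm} (j : ℕ) : Derives T Γ φ.allFn → Derives T Γ (φ.instFn j)
  | eqI {Γ : List Fm} (t : Tm) : Derives T Γ (Fm.eq t t)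
  | eqE {Γ : List Fm} {φ : Fm} {s t : Tm} :
      Derives T Γ (Fm.eq s t) → Derives T Γ (φ.inst s) → Derives T Γ (φ.inst t)

/-! ### The theory `S^1_2` -/

section Axioms

open Tm Fm

local infixr:25 " ⟹ " => Fm.imp
local infix:20 " ⟺ " => Fm.iff
local infixl:35 " ⩑ " => Fm.and
local infixl:30 " ⩒ " => Fm.or
local infix:50 " ≐ " => Fm.eq
local infix:50 " ≼ " => Fm.le
local prefix:max "∼" => Fm.neg
local notation "xx" => Tm.var 0
local notation "yy" => Tm.var 1
local notation "zz" => Tm.var 2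
local notation "uu" => Tm.var 3
local notation "vv" => Tm.var 4
local notation "two" => ((1 : Tm) + 1)

/-- Buss's open axioms (with `x + 1` for the successor of `x`) and the four axioms for the
function giving the most significant bits. -/
def basicAxioms : List Fm :=
  [ yy ≼ xx ⟹ yy ≼ xx + 1,
    ∼(xx ≐ xx + 1),
    0 ≼ xx,
    xx ≼ yy ⩑ ∼(xx ≐ yy) ⟺ xx + 1 ≼ yy,
    ∼(xx ≐ 0) ⟹ ∼(two * xx ≐ 0),
    yy ≼ xx ⩒ xx ≼ yy,
    xx ≼ yy ⩑ yy ≼ xx ⟹ xx ≐ yy,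
    xx ≼ yy ⩑ yy ≼ zz ⟹ xx ≼ zz,
    len 0 ≐ 0,
    ∼(xx ≐ 0) ⟹ len (two * xx) ≐ len xx + 1 ⩑ len (two * xx + 1) ≐ len xx + 1,
    len 1 ≐ 1,
    xx ≼ yy ⟹ len xx ≼ len yy,
    len (smash xx yy) ≐ len xx * len yy + 1,
    smash 0 yy ≐ 1,
    ∼(xx ≐ 0) ⟹ smash 1 (two * xx) ≐ two * smash 1 xx ⩑
      smash 1 (two * xx + 1) ≐ two * smash 1 xx,
    smash xx yy ≐ smash yy xx,
    len xx ≐ len yy ⟹ smash xx zz ≐ smash yy zz,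
    len xx ≐ len uu + len vv ⟹ smash xx yy ≐ smash uu yy * smash vv yy,
    xx ≼ xx + yy,
    xx ≼ yy ⩑ ∼(xx ≐ yy) ⟹ two * xx + 1 ≼ two * yy ⩑ ∼(two * xx + 1 ≐ two * yy),
    xx + yy ≐ yy + xx,
    xx + 0 ≐ xx,
    xx + (yy + 1) ≐ (xx + yy) + 1,
    (xx + yy) + zz ≐ xx + (yy + zz),
    xx + yy ≼ xx + zz ⟺ yy ≼ zz,
    xx * 0 ≐ 0,
    xx * (yy + 1) ≐ xx * yy + xx,
    xx * yy ≐ yy * xx,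
    xx * (yy + zz) ≐ xx * yy + xx * zz,
    1 ≼ xx ⟹ (xx * yy ≼ xx * zz ⟺ yy ≼ zz),
    ∼(xx ≐ 0) ⟹ len xx ≐ len (half xx) + 1,
    xx ≐ half yy ⟺ two * xx ≐ yy ⩒ two * xx + 1 ≐ yy,
    msp xx 0 ≐ 0,
    1 ≼ xx ⟹ msp xx 1 ≐ 1,
    yy + 1 ≼ len xx ⟹ msp xx yy ≐ half (msp xx (yy + 1)),
    len xx ≼ yy ⟹ msp xx yy ≐ xx ]

/-- The instance
`A(0) ∧ (∀ x, A(⌊x/2⌋) → A(x)) → ∀ x, A(x)` of polynomial induction. Here `x` is the number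
variable with index `0`; all other free variables of `A` are parameters. -/
def pind (A : Fm) : Fm :=
  A.inst 0 ⩑
    Fm.all (A.subst id (cons (half (Tm.var 0)) fun i => Tm.var (i + 1)) ⟹ A) ⟹
  Fm.all A

end Axioms

/-- The theory `S^1_2 = BASIC + (Σ^b_1-PIND)`. -/
def S12 : Set Fm := {φ | φ ∈ basicAxioms} ∪ {φ | ∃ A, IsSigmaB1 A ∧ φ = pind A}

/-- `S^1_2 ⊢ φ`. -/
def S12Proves (φ : Fm) : Prop := Derives S12 [] φ

/-! ### Definability -/

/-- `F` is `Σ^b_1`-definable in `S^1_2`: there are a `Σ^b_1` formula `Ψ(f⃗, x⃗, y)` and terms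
`t₁(f⃗, x⃗), t₂(f⃗, x⃗, z₁), …, t_p(f⃗, x⃗, z₁, …, z_{p-1})` and `t(f⃗, x⃗, z₁, …, z_p)` such that

* `S^1_2 ⊢ ∀ f⃗ ∀ x⃗ ∃ z₁ ≤ t₁ … ∃ z_p ≤ t_p ∃ y ≤ t Ψ(f⃗, x⃗, y)`,
* `S^1_2 ⊢ ∀ f⃗ ∀ x⃗ ∃! y Ψ(f⃗, x⃗, y)`,
* `Ψ(f⃗, x⃗, F(f⃗, x⃗))` is true in the standard model for all `f⃗` and `x⃗`.

In `Ψ` the number variable with index `0` is `y` and those with indices `1, …, l` are `x⃗`;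
below the prefix, `x⃗` is preceded by `y, z_p, …, z₁`. -/
def SigmaB1Definable {k l : ℕ} (F : Functional k l) : Prop :=
  ∃ (Ψ : Fm) (ts : List Tm) (t : Tm),
    IsSigmaB1 Ψ ∧ Ψ.Scoped k (l + 1) ∧
    (Fm.bexs ts (Fm.bex t
      (Ψ.subst id (cons (Tm.var 0) fun i => Tm.var (i + 1 + ts.length))))).Scoped k l ∧
    S12Proves (Fm.allFns k (Fm.alls l (Fm.bexs ts (Fm.bex t
      (Ψ.subst id (cons (Tm.var 0) fun i => Tm.var (i + 1 + ts.length))))))) ∧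
    S12Proves (Fm.allFns k (Fm.alls l Ψ.exUnique)) ∧
    ∀ (f : ℕ → ℕ → ℕ) (x : ℕ → ℕ),
      Ψ.Holds f (cons (F (fun j : Fin k => f j) (fun i : Fin l => x i)) x)

end BFF

namespace BFF

/-! ### Substitution -/

/-! Provability in S^1_2 is replaced by truth in all its models: completeness of the two-sorted
calculus is proved by Henkin's method (`derives_of_forall_model`). After that, everything happens
inside an arbitrary model, and the standard model is consulted only to identify the function that
has been defined.

The working notion is `Dfn`: a Σ^b_1 graph that defines, in every model, a total function whose
value is bounded by a term below a prefix of bounded quantifiers. It is enough to find, for each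
basic feasible F, a `Dfn` whose function in the standard model is F (`exists_represents`); the
theory need not prove anything else about F. A defined function may be used inside Σ^b_1 formulas
without leaving the class (`Dfn.bind`). The initial functionals are terms, and composition
concatenates prefixes, the inner value becoming one of the quantified variables.

Limited recursion is the hard case. The inequality |F| ≤ |K| is true in ℕ but is not known in other
models, so the recursion is truncated: R(y) = S(y, R(⌊y/2⌋)) ↾ |b|. The number b must dominate K at
all prefixes of y at once, and K, which depends on arbitrary functions, need not be monotone. Hence
b is the maximum of K over these prefixes (`Dfn.max`), and the index where it is attained is
quantified in the prefix; this is what the variables z₁, …, z_p are needed for. In ℕ the truncation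
is void and R = F (`Dfn.stdVal_truncRec`).

Truncated values lie below 1 # b = 2^|b|, so the whole computation is coded by one number w ≤ (y #
b)(1 # b), whose digits in base 1 # b are the values of R at the prefixes of y. Correctness of w up
to a given length is Σ^b_1. Existence of w (`Dfn.exists_recStep`) and uniqueness of the digit that
is output (`Dfn.dig_unique_of_recStep`) follow by induction up to |y| (`S12Model.lind`). What
remains is arithmetic in models: an ordered semiring, powers of two, subtraction and division,
obtained from BASIC and PIND. -/

@[simp] theorem cons_zero {α : Type} (a : α) (v : ℕ → α) : cons a v 0 = a := rfl
@[simp] theorem cons_succ {α : Type} (a : α) (v : ℕ → α) (i : ℕ) : cons a v (i + 1) = v i := rfl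

theorem comp_cons {α β : Type} (g : α → β) (a : α) (v : ℕ → α) :
    (fun i => g (cons a v i)) = cons (g a) fun i => g (v i) := by
  funext i; cases i <;> rfl

/-- The substitution for number variables under a number quantifier. -/
def liftN (σ : ℕ → Tm) : ℕ → Tm := cons (Tm.var 0) fun i => (σ i).shift

/-- The substitution for function variables under a function quantifier. -/
def liftF (ρ : ℕ → ℕ) : ℕ → ℕ := cons 0 fun j => ρ j + 1

theorem Tm.subst_subst (ρ ρ' : ℕ → ℕ) (σ σ' : ℕ → Tm) (t : Tm) :
    (t.subst ρ σ).subst ρ' σ' = t.subst (fun j => ρ' (ρ j)) fun i => (σ i).subst ρ' σ' := by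
  induction t <;> simp_all [Tm.subst]

theorem Tm.subst_var (t : Tm) : t.subst id Tm.var = t := by
  induction t <;> simp_all [Tm.subst]

theorem liftF_id : liftF id = id := by funext i; cases i <;> rfl

theorem liftN_var : liftN Tm.var = Tm.var := by funext i; cases i <;> rfl

theorem Fm.subst_all (ρ : ℕ → ℕ) (σ : ℕ → Tm) (φ : Fm) :
    φ.all.subst ρ σ = (φ.subst ρ (liftN σ)).all := rfl

theorem Fm.subst_allFn (ρ : ℕ → ℕ) (σ : ℕ → Tm) (φ : Fm) :
    φ.allFn.subst ρ σ = (φ.subst (liftF ρ) fun i => (σ i).shiftFn).allFn := rfl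

theorem Fm.subst_var (φ : Fm) : φ.subst id Tm.var = φ := by
  induction φ with
  | bot => rfl
  | eq s t => simp [Fm.subst, Tm.subst_var]
  | le s t => simp [Fm.subst, Tm.subst_var]
  | imp φ ψ h h' => simp [Fm.subst, h, h']
  | all φ h => rw [Fm.subst_all, liftN_var, h]
  | allFn φ h =>
    rw [Fm.subst_allFn, liftF_id]
    exact congrArg _ h

theorem liftN_subst (ρ' : ℕ → ℕ) (σ σ' : ℕ → Tm) :
    (fun i => (liftN σ i).subst ρ' (liftN σ')) = liftN fun i => (σ i).subst ρ' σ' := by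
  funext i
  cases i with
  | zero => rfl
  | succ i => simp [liftN, Tm.shift, Tm.subst_subst, Tm.subst]

theorem shiftFn_subst (ρ' : ℕ → ℕ) (σ' : ℕ → Tm) (t : Tm) :
    t.shiftFn.subst (liftF ρ') (fun i => (σ' i).shiftFn) = (t.subst ρ' σ').shiftFn := by
  simp [liftF, Tm.shiftFn, Tm.subst_subst, Tm.subst]

theorem Fm.subst_subst (ρ ρ' : ℕ → ℕ) (σ σ' : ℕ → Tm) (φ : Fm) :
    (φ.subst ρ σ).subst ρ' σ' = φ.subst (fun j => ρ' (ρ j)) fun i => (σ i).subst ρ' σ' := by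
  induction φ generalizing ρ ρ' σ σ' with
  | bot => rfl
  | eq s t => simp [Fm.subst, Tm.subst_subst]
  | le s t => simp [Fm.subst, Tm.subst_subst]
  | imp φ ψ h h' => simp [Fm.subst, h, h']
  | all φ h => simp only [Fm.subst_all, h, liftN_subst]
  | allFn φ h =>
    have : (fun j => liftF ρ' (liftF ρ j)) = liftF fun j => ρ' (ρ j) := by
      funext i; cases i <;> rfl
    simp only [Fm.subst_allFn, h, shiftFn_subst, this]

theorem Fm.inst_subst (ρ : ℕ → ℕ) (σ : ℕ → Tm) (t : Tm) (φ : Fm) :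
    (φ.subst ρ (liftN σ)).inst t = φ.subst ρ (cons t σ) := by
  rw [Fm.inst, Fm.subst_subst]
  congr 1
  funext i
  cases i with
  | zero => rfl
  | succ i => simp [liftN, Tm.shift, Tm.subst_subst, Tm.subst]; exact Tm.subst_var _

theorem Fm.subst_inst (ρ : ℕ → ℕ) (σ : ℕ → Tm) (t : Tm) (φ : Fm) :
    (φ.inst t).subst ρ σ = (φ.subst ρ (liftN σ)).inst (t.subst ρ σ) := by
  rw [Fm.inst_subst, Fm.inst, Fm.subst_subst]
  congr 1
  funext i; cases i <;> rfl

theorem Fm.instFn_subst (ρ : ℕ → ℕ) (σ : ℕ → Tm) (j : ℕ) (φ : Fm) :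
    (φ.subst (liftF ρ) fun i => (σ i).shiftFn).instFn j = φ.subst (cons j ρ) σ := by
  rw [Fm.instFn, Fm.subst_subst]
  congr 1
  · funext i; cases i <;> rfl
  · funext i
    simp [Tm.shiftFn, Tm.subst_subst]; exact Tm.subst_var _

theorem Fm.subst_instFn (ρ : ℕ → ℕ) (σ : ℕ → Tm) (j : ℕ) (φ : Fm) :
    (φ.instFn j).subst ρ σ = (φ.subst (liftF ρ) fun i => (σ i).shiftFn).instFn (ρ j) := by
  rw [Fm.instFn_subst, Fm.instFn, Fm.subst_subst]
  congr 1
  funext i; cases i <;> rfl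

theorem Fm.shift_subst (ρ : ℕ → ℕ) (σ : ℕ → Tm) (φ : Fm) :
    φ.shift.subst ρ (liftN σ) = (φ.subst ρ σ).shift := by
  simp only [Fm.shift, Fm.subst_subst]; rfl

theorem Fm.shiftFn_subst (ρ : ℕ → ℕ) (σ : ℕ → Tm) (φ : Fm) :
    φ.shiftFn.subst (liftF ρ) (fun i => (σ i).shiftFn) = (φ.subst ρ σ).shiftFn := by
  simp only [Fm.shiftFn, Fm.subst_subst]; rfl

/-! ### Variables that occur -/

theorem Tm.Scoped.mono {k k' n n' : ℕ} (hk : k ≤ k') (hn : n ≤ n') {t : Tm} (h : t.Scoped k n) :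
    t.Scoped k' n' := by
  induction t <;> simp_all [Tm.Scoped] <;> omega

theorem Fm.Scoped.mono {k k' n n' : ℕ} (hk : k ≤ k') (hn : n ≤ n') {φ : Fm} (h : φ.Scoped k n) :
    φ.Scoped k' n' := by
  induction φ generalizing k k' n n' with
  | bot => trivial
  | eq s t => exact ⟨h.1.mono hk hn, h.2.mono hk hn⟩
  | le s t => exact ⟨h.1.mono hk hn, h.2.mono hk hn⟩
  | imp φ ψ h₁ h₂ => exact ⟨h₁ hk hn h.1, h₂ hk hn h.2⟩
  | all φ ih => exact ih (k' := k') hk (Nat.succ_le_succ hn) h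
  | allFn φ ih => exact ih (n' := n') (Nat.succ_le_succ hk) hn h

theorem Tm.exists_scoped (t : Tm) : ∃ n, t.Scoped n n := by
  induction t with
  | var i => exact ⟨i + 1, Nat.lt_succ_self i⟩
  | zero => exact ⟨0, trivial⟩
  | one => exact ⟨0, trivial⟩
  | add s t hs ht | mul s t hs ht | smash s t hs ht | msp s t hs ht =>
    obtain ⟨a, ha⟩ := hs
    obtain ⟨b, hb⟩ := ht
    exact ⟨max a b, ha.mono (le_max_left _ _) (le_max_left _ _),
      hb.mono (le_max_right _ _) (le_max_right _ _)⟩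
  | len t ht => exact ht
  | half t ht => exact ht
  | ap j t ht =>
    obtain ⟨b, hb⟩ := ht
    exact ⟨max (j + 1) b, (Nat.lt_succ_self j).trans_le (le_max_left _ _),
      hb.mono (le_max_right _ _) (le_max_right _ _)⟩

theorem Fm.exists_scoped (φ : Fm) : ∃ n, φ.Scoped n n := by
  induction φ with
  | bot => exact ⟨0, trivial⟩
  | eq s t | le s t =>
    obtain ⟨a, ha⟩ := s.exists_scoped
    obtain ⟨b, hb⟩ := t.exists_scoped
    exact ⟨max a b, ha.mono (le_max_left _ _) (le_max_left _ _),
      hb.mono (le_max_right _ _) (le_max_right _ _)⟩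
  | imp φ ψ h h' =>
    obtain ⟨a, ha⟩ := h
    obtain ⟨b, hb⟩ := h'
    exact ⟨max a b, ha.mono (le_max_left _ _) (le_max_left _ _),
      hb.mono (le_max_right _ _) (le_max_right _ _)⟩
  | all φ h | allFn φ h =>
    obtain ⟨a, ha⟩ := h
    exact ⟨a, Fm.Scoped.mono (φ := φ) (k := a) (n := a) (by omega) (by omega) ha⟩

theorem exists_scoped_list (Γ : List Fm) : ∃ n, ∀ φ ∈ Γ, φ.Scoped n n := by
  induction Γ with
  | nil => exact ⟨0, by simp⟩
  | cons φ Γ ih =>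
    obtain ⟨a, ha⟩ := φ.exists_scoped
    obtain ⟨b, hb⟩ := ih
    refine ⟨max a b, ?_⟩
    rintro ψ hψ
    rcases List.mem_cons.1 hψ with rfl | hψ
    · exact ha.mono (le_max_left _ _) (le_max_left _ _)
    · exact (hb ψ hψ).mono (le_max_right _ _) (le_max_right _ _)

theorem Tm.Scoped.subst_congr {k n : ℕ} {ρ ρ' : ℕ → ℕ} {σ σ' : ℕ → Tm}
    (hρ : ∀ j < k, ρ j = ρ' j) (hσ : ∀ i < n, σ i = σ' i) {t : Tm} (h : t.Scoped k n) :
    t.subst ρ σ = t.subst ρ' σ' := by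
  induction t <;> simp_all [Tm.Scoped, Tm.subst]

theorem Fm.Scoped.subst_congr {k n : ℕ} {ρ ρ' : ℕ → ℕ} {σ σ' : ℕ → Tm}
    (hρ : ∀ j < k, ρ j = ρ' j) (hσ : ∀ i < n, σ i = σ' i) {φ : Fm} (h : φ.Scoped k n) :
    φ.subst ρ σ = φ.subst ρ' σ' := by
  induction φ generalizing k n ρ ρ' σ σ' with
  | bot => rfl
  | eq s t | le s t => simp only [Fm.subst, h.1.subst_congr hρ hσ, h.2.subst_congr hρ hσ]
  | imp φ ψ h₁ h₂ => simp only [Fm.subst, h₁ hρ hσ h.1, h₂ hρ hσ h.2]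
  | all φ ih =>
    rw [Fm.subst_all, Fm.subst_all, ih hρ _ h]
    rintro (_ | i) hi
    · rfl
    · simp [liftN, hσ i (by omega)]
  | allFn φ ih =>
    rw [Fm.subst_allFn, Fm.subst_allFn, ih _ _ h]
    · rintro (_ | i) hi
      · rfl
      · simp [liftF, hρ i (by omega)]
    · intro i hi
      simp [hσ i hi]

/-! ### Derivations -/

theorem Derives.weaken {T : Set Fm} {Γ Δ : List Fm} {φ : Fm} (h : Derives T Γ φ) (hΓ : Γ ⊆ Δ) :
    Derives T Δ φ := by
  induction h generalizing Δ with
  | ax h => exact .ax h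
  | hyp h => exact .hyp (hΓ h)
  | impI _ ih => exact .impI (ih (List.cons_subset_cons _ hΓ))
  | impE _ _ ih ih' => exact .impE (ih hΓ) (ih' hΓ)
  | contra _ ih => exact .contra (ih (List.cons_subset_cons _ hΓ))
  | allI _ ih => exact .allI (ih (List.map_subset _ hΓ))
  | allE t _ ih => exact .allE t (ih hΓ)
  | allFnI _ ih => exact .allFnI (ih (List.map_subset _ hΓ))
  | allFnE j _ ih => exact .allFnE j (ih hΓ)
  | eqI t => exact .eqI t
  | eqE _ _ ih ih' => exact .eqE (ih hΓ) (ih' hΓ)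

/-- Without hypotheses `allI` has no side condition, so variables can be generalized and
instantiated one after the other. -/
theorem Derives.subst_num_nil {T : Set Fm} {φ : Fm} (n : ℕ) (σ : ℕ → Tm)
    (h : Derives T [] φ) :
    Derives T [] (φ.subst id fun i => if i < n then σ i else Tm.var (i - n)) := by
  induction n generalizing φ σ with
  | zero => simpa [Fm.subst_var] using h
  | succ n ih =>
    -- Raising `σ 0` by `n` protects its variables: the remaining substitutions touch only indices
    -- below `n` and lower the others by `n`.
    have h1 := ih (fun i => σ (i + 1))
      (Derives.allE ((σ 0).subst id fun i => Tm.var (i + n)) (Derives.allI (Γ := []) h))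
    rw [Fm.inst, Fm.subst_subst] at h1
    refine Eq.subst (motive := Derives T []) ?_ h1
    congr 1
    funext i
    cases i with
    | zero =>
      simp only [cons_zero, Tm.subst_subst, Nat.zero_lt_succ, if_true, Tm.subst]
      refine Eq.trans ?_ (Tm.subst_var (σ 0))
      congr 1
      funext i
      simp
    | succ i => simp [Tm.subst]

theorem Derives.subst_fn_nil {T : Set Fm} {φ : Fm} (n : ℕ) (ρ : ℕ → ℕ)
    (h : Derives T [] φ) :
    Derives T [] (φ.subst (fun j => if j < n then ρ j else j - n) Tm.var) := by
  induction n generalizing φ ρ with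
  | zero => simpa using (Fm.subst_var φ).symm ▸ h
  | succ n ih =>
    have h1 := ih (fun i => ρ (i + 1))
      (Derives.allFnE (ρ 0 + n) (Derives.allFnI (Γ := []) h))
    rw [Fm.instFn, Fm.subst_subst] at h1
    refine Eq.subst (motive := Derives T []) ?_ h1
    congr 1
    funext i
    cases i with
    | zero => simp
    | succ i => by_cases hi : i < n <;> simp [hi]

/-- Only finitely many variables occur in `φ`, so a finite substitution has the same effect. -/
theorem Derives.subst_nil {T : Set Fm} {φ : Fm} (ρ : ℕ → ℕ) (σ : ℕ → Tm)
    (h : Derives T [] φ) : Derives T [] (φ.subst ρ σ) := by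
  obtain ⟨n, hn⟩ := φ.exists_scoped
  have h1 := (h.subst_fn_nil n ρ).subst_num_nil n σ
  rw [Fm.subst_subst] at h1
  convert h1 using 1
  refine hn.subst_congr ?_ ?_
  · intro j hj; simp [hj]
  · intro i hi; simp [hi, Tm.subst]

/-- `T` need not be closed under substitution: instances of its open axioms are derivable by
`Derives.subst_nil`. -/
theorem Derives.subst {T : Set Fm} {Γ : List Fm} {φ : Fm} (h : Derives T Γ φ) (ρ : ℕ → ℕ)
    (σ : ℕ → Tm) : Derives T (Γ.map (Fm.subst ρ σ)) (φ.subst ρ σ) := by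
  induction h generalizing ρ σ with
  | ax h => exact (Derives.subst_nil ρ σ (.ax h)).weaken (by simp)
  | hyp h => exact .hyp (List.mem_map_of_mem h)
  | impI _ ih => exact .impI (ih ρ σ)
  | impE _ _ ih ih' => exact .impE (ih ρ σ) (ih' ρ σ)
  | contra _ ih => exact .contra (ih ρ σ)
  | allI _ ih =>
    refine .allI ?_
    convert ih ρ (liftN σ) using 1
    · simp [Function.comp_def, Fm.shift_subst]
    · rfl
  | allE t _ ih =>
    rw [Fm.subst_inst]
    exact .allE _ (ih ρ σ)
  | allFnI _ ih =>
    refine .allFnI ?_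
    convert ih (liftF ρ) (fun i => (σ i).shiftFn) using 1
    · simp [Function.comp_def, Fm.shiftFn_subst]
    · rfl
  | allFnE j _ ih =>
    rw [Fm.subst_instFn]
    exact .allFnE _ (ih ρ σ)
  | eqI t => exact .eqI _
  | eqE _ _ ih ih' =>
    rw [Fm.subst_inst]
    refine .eqE (ih ρ σ) ?_
    rw [← Fm.subst_inst]
    exact ih' ρ σ

/-- Variables double as Henkin constants. Renaming `m` to 0 and raising the other variables turns
the given derivation into the premise of `allI`. -/
theorem Derives.all_of_fresh {T : Set Fm} {Γ : List Fm} {φ : Fm} {m : ℕ}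
    (hΓ : ∀ ψ ∈ Γ, ψ.Scoped m m) (hφ : φ.Scoped m (m + 1)) (h : Derives T Γ (φ.inst (Tm.var m))) :
    Derives T Γ φ.all := by
  have h1 := h.subst id fun i => if i = m then Tm.var 0 else Tm.var (i + 1)
  refine .allI ?_
  convert h1 using 1
  · refine List.map_congr_left fun ψ hψ => (hΓ ψ hψ).subst_congr (fun _ _ => rfl) ?_
    intro i hi
    simp [hi.ne]
  · rw [Fm.inst, Fm.subst_subst]
    refine (Fm.subst_var φ).symm.trans (hφ.subst_congr (fun _ _ => rfl) ?_)
    rintro (_ | i) hi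
    · simp [Tm.subst]
    · have : i ≠ m := by omega
      simp [Tm.subst, this]

theorem Derives.allFn_of_fresh {T : Set Fm} {Γ : List Fm} {φ : Fm} {m : ℕ}
    (hΓ : ∀ ψ ∈ Γ, ψ.Scoped m m) (hφ : φ.Scoped (m + 1) m) (h : Derives T Γ (φ.instFn m)) :
    Derives T Γ φ.allFn := by
  have h1 := h.subst (fun i => if i = m then 0 else i + 1) Tm.var
  refine .allFnI ?_
  convert h1 using 1
  · refine List.map_congr_left fun ψ hψ => (hΓ ψ hψ).subst_congr ?_ (fun _ _ => rfl)
    intro i hi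
    simp [hi.ne]
  · rw [Fm.instFn, Fm.subst_subst]
    refine (Fm.subst_var φ).symm.trans (hφ.subst_congr ?_ (fun _ _ => rfl))
    rintro (_ | i) hi
    · simp
    · have : i ≠ m := by omega
      simp [this]

/-! ### Models -/

/-- Structures for the two-sorted language, with a domain of numbers and a domain of functions. -/
structure Model where
  Num : Type
  Fn : Type
  zero : Num
  one : Num
  add : Num → Num → Num
  mul : Num → Num → Num
  len : Num → Num
  half : Num → Num
  smash : Num → Num → Num
  msp : Num → Num → Num
  ap : Fn → Num → Num
  le : Num → Num → Prop

/-- The value of a term. -/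
def Tm.val (A : Model) (f : ℕ → A.Fn) (v : ℕ → A.Num) : Tm → A.Num
  | var i => v i
  | zero => A.zero
  | one => A.one
  | add s t => A.add (s.val A f v) (t.val A f v)
  | mul s t => A.mul (s.val A f v) (t.val A f v)
  | len t => A.len (t.val A f v)
  | half t => A.half (t.val A f v)
  | smash s t => A.smash (s.val A f v) (t.val A f v)
  | msp s t => A.msp (s.val A f v) (t.val A f v)
  | ap j t => A.ap (f j) (t.val A f v)

/-- Satisfaction. -/
def Fm.Sat (A : Model) : (ℕ → A.Fn) → (ℕ → A.Num) → Fm → Prop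
  | _, _, bot => False
  | f, v, eq s t => s.val A f v = t.val A f v
  | f, v, le s t => A.le (s.val A f v) (t.val A f v)
  | f, v, imp φ ψ => φ.Sat A f v → ψ.Sat A f v
  | f, v, all φ => ∀ a : A.Num, φ.Sat A f (cons a v)
  | f, v, allFn φ => ∀ g : A.Fn, φ.Sat A (cons g f) v

/-- All axioms in `T` are true in `A`. -/
def Model.Satisfies (A : Model) (T : Set Fm) : Prop := ∀ φ ∈ T, ∀ f v, φ.Sat A f v

theorem Tm.val_subst (A : Model) (f : ℕ → A.Fn) (v : ℕ → A.Num) (ρ : ℕ → ℕ) (σ : ℕ → Tm)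
    (t : Tm) :
    (t.subst ρ σ).val A f v = t.val A (fun j => f (ρ j)) fun i => (σ i).val A f v := by
  induction t <;> simp_all [Tm.subst, Tm.val]

theorem Tm.val_shift (A : Model) (f : ℕ → A.Fn) (a : A.Num) (v : ℕ → A.Num) (t : Tm) :
    t.shift.val A f (cons a v) = t.val A f v := by
  simp [Tm.shift, Tm.val_subst, Tm.val]

theorem Fm.sat_subst (A : Model) (f : ℕ → A.Fn) (v : ℕ → A.Num) (ρ : ℕ → ℕ) (σ : ℕ → Tm)
    (φ : Fm) :
    (φ.subst ρ σ).Sat A f v ↔ φ.Sat A (fun j => f (ρ j)) fun i => (σ i).val A f v := by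
  induction φ generalizing f v ρ σ with
  | bot => rfl
  | eq s t | le s t => simp [Fm.subst, Fm.Sat, Tm.val_subst]
  | imp φ ψ h h' => simp [Fm.subst, Fm.Sat, h, h']
  | all φ ih =>
    simp only [Fm.subst_all, Fm.Sat, ih]
    refine forall_congr' fun a => ?_
    have : (fun i => (liftN σ i).val A f (cons a v)) = cons a fun i => (σ i).val A f v := by
      funext i
      cases i with
      | zero => rfl
      | succ i => exact Tm.val_shift A f a v (σ i)
    rw [this]
  | allFn φ ih =>
    simp only [Fm.subst_allFn, Fm.Sat, ih]
    refine forall_congr' fun g => ?_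
    have h1 : (fun j => cons g f (liftF ρ j)) = cons g fun j => f (ρ j) := by
      funext i; cases i <;> rfl
    have h2 : (fun i => (σ i).shiftFn.val A (cons g f) v) = fun i => (σ i).val A f v := by
      funext i
      simp [Tm.shiftFn, Tm.val_subst, Tm.val]
    rw [h1, h2]

/-! ### Completeness -/

/-- An injective coding of terms by numbers. -/
def Tm.code : Tm → ℕ
  | var i => Nat.pair 0 i
  | zero => Nat.pair 1 0
  | one => Nat.pair 2 0
  | add s t => Nat.pair 3 (Nat.pair s.code t.code)
  | mul s t => Nat.pair 4 (Nat.pair s.code t.code)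
  | len t => Nat.pair 5 t.code
  | half t => Nat.pair 6 t.code
  | smash s t => Nat.pair 7 (Nat.pair s.code t.code)
  | msp s t => Nat.pair 8 (Nat.pair s.code t.code)
  | ap j t => Nat.pair 9 (Nat.pair j t.code)

theorem Tm.code_injective : Function.Injective Tm.code := by
  intro s
  induction s <;> intro t h <;> cases t <;> simp_all [Tm.code, Nat.pair_eq_pair] <;> grind

/-- An injective coding of formulas by numbers. -/
def Fm.code : Fm → ℕ
  | bot => Nat.pair 0 0
  | eq s t => Nat.pair 1 (Nat.pair s.code t.code)
  | le s t => Nat.pair 2 (Nat.pair s.code t.code)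
  | imp φ ψ => Nat.pair 3 (Nat.pair φ.code ψ.code)
  | all φ => Nat.pair 4 φ.code
  | allFn φ => Nat.pair 5 φ.code

theorem Fm.code_injective : Function.Injective Fm.code := by
  intro s
  induction s <;> intro t h <;> cases t <;>
    simp_all [Fm.code, Nat.pair_eq_pair, Tm.code_injective.eq_iff] <;> grind

instance : Countable Fm := Fm.code_injective.countable

instance : Inhabited Fm := ⟨Fm.bot⟩

theorem Derives.exFalso {T : Set Fm} {Γ : List Fm} {φ : Fm} (h : Derives T Γ Fm.bot) :
    Derives T Γ φ :=
  .contra (h.weaken (by simp))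

theorem Derives.cut {T : Set Fm} {Γ : List Fm} {φ ψ : Fm} (h : Derives T Γ φ)
    (h' : Derives T (φ :: Γ) ψ) : Derives T Γ ψ := .impE (.impI h') h

/-- `ψ` is decided by `Γ`, with a counterexample if it is a generalization that is refuted. -/
def Decided (Γ : List Fm) (ψ : Fm) : Prop :=
  ψ ∈ Γ ∨ (ψ.neg ∈ Γ ∧ (∀ χ, ψ = Fm.all χ → ∃ t, (χ.inst t).neg ∈ Γ) ∧
    ∀ χ, ψ = Fm.allFn χ → ∃ j, (χ.instFn j).neg ∈ Γ)

theorem exists_decided {T : Set Fm} {Γ : List Fm} (hΓ : ¬ Derives T Γ Fm.bot) (ψ : Fm) :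
    ∃ Δ, Γ ⊆ Δ ∧ ¬ Derives T Δ Fm.bot ∧ Decided Δ ψ := by
  -- If `ψ` is inconsistent with `Γ`, its negation is consistent; for a generalization, a
  -- counterexample at a fresh variable `m` can be added as well.
  by_cases h : Derives T (ψ :: Γ) Fm.bot
  · have h1 : ¬ Derives T (ψ.neg :: Γ) Fm.bot := fun h' => hΓ (.cut (.impI h) h')
    obtain ⟨m, hm⟩ := exists_scoped_list (ψ.neg :: Γ)
    have hψ : ψ.Scoped m m := (hm ψ.neg List.mem_cons_self).1
    by_cases h2 : ∃ χ, ψ = Fm.all χ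
    · obtain ⟨χ, rfl⟩ := h2
      refine ⟨(χ.inst (Tm.var m)).neg :: χ.all.neg :: Γ, fun x hx => by simp [hx], fun h3 => h1 ?_,
        Or.inr ⟨by simp, ?_, by simp⟩⟩
      · refine .impE (.hyp List.mem_cons_self) (Derives.all_of_fresh hm hψ (.contra h3))
      · rintro χ' h
        cases h
        exact ⟨Tm.var m, by simp⟩
    · by_cases h3 : ∃ χ, ψ = Fm.allFn χ
      · obtain ⟨χ, rfl⟩ := h3
        refine ⟨(χ.instFn m).neg :: χ.allFn.neg :: Γ, fun x hx => by simp [hx], fun h3 => h1 ?_,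
          Or.inr ⟨by simp, by simp, ?_⟩⟩
        · refine .impE (.hyp List.mem_cons_self) (Derives.allFn_of_fresh hm hψ (.contra h3))
        · rintro χ' h
          cases h
          exact ⟨m, by simp⟩
      · push Not at h2 h3
        exact ⟨ψ.neg :: Γ, by simp, h1, Or.inr ⟨by simp, fun χ h => absurd h (h2 χ),
          fun χ h => absurd h (h3 χ)⟩⟩
  · exact ⟨ψ :: Γ, by simp, h, Or.inl (by simp)⟩

/-- Maximal consistent sets with witnesses. -/
structure IsHenkin (T S : Set Fm) : Prop where
  closed : ∀ {Γ : List Fm} {φ : Fm}, (∀ ψ ∈ Γ, ψ ∈ S) → Derives T Γ φ → φ ∈ S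
  bot : Fm.bot ∉ S
  total : ∀ φ : Fm, φ ∈ S ∨ φ.neg ∈ S
  all : ∀ φ : Fm, (∀ t, φ.inst t ∈ S) → φ.all ∈ S
  allFn : ∀ φ : Fm, (∀ j, φ.instFn j ∈ S) → φ.allFn ∈ S

/-- The set is the union of a chain of finite consistent lists, the `n`-th formula of an enumeration
being decided at stage `n`. Since every stage is finite, fresh variables never run out and the
language needs no new constants. -/
theorem exists_isHenkin {T : Set Fm} {Γ : List Fm} (hΓ : ¬ Derives T Γ Fm.bot) :
    ∃ S, IsHenkin T S ∧ ∀ φ ∈ Γ, φ ∈ S := by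
  obtain ⟨e, he⟩ := exists_surjective_nat Fm
  choose g hg₁ hg₂ hg₃ using
    fun (p : {Γ : List Fm // ¬ Derives T Γ Fm.bot}) (ψ : Fm) => exists_decided p.2 ψ
  let s : ℕ → {Γ : List Fm // ¬ Derives T Γ Fm.bot} := fun n =>
    Nat.rec ⟨Γ, hΓ⟩ (fun n p => ⟨g p (e n), hg₂ p (e n)⟩) n
  have hs : ∀ n, (s (n + 1)).1 = g (s n) (e n) := fun n => rfl
  have hmono : Monotone fun n => {φ | φ ∈ (s n).1} :=
    monotone_nat_of_le_succ fun n φ hφ => by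
      change φ ∈ (s (n + 1)).1
      rw [hs]
      exact hg₁ _ _ hφ
  -- A finite part of the union already lies in a single stage, hence is consistent.
  have hcons : ∀ Δ : List Fm, (∀ ψ ∈ Δ, ∃ n, ψ ∈ (s n).1) → ¬ Derives T Δ Fm.bot := by
    intro Δ hΔ h
    have : ∃ n, ∀ ψ ∈ Δ, ψ ∈ (s n).1 := by
      clear h
      induction Δ with
      | nil => exact ⟨0, by simp⟩
      | cons ψ Δ ih =>
        obtain ⟨n, hn⟩ := ih fun χ hχ => hΔ χ (List.mem_cons_of_mem _ hχ)
        obtain ⟨m, hm⟩ := hΔ ψ List.mem_cons_self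
        refine ⟨max n m, fun χ hχ => ?_⟩
        rcases List.mem_cons.1 hχ with rfl | hχ
        · exact hmono (le_max_right n m) hm
        · exact hmono (le_max_left n m) (hn χ hχ)
    obtain ⟨n, hn⟩ := this
    exact (s n).2 (h.weaken hn)
  have hdec : ∀ ψ, ∃ n, Decided (s n).1 ψ := fun ψ => by
    obtain ⟨n, rfl⟩ := he ψ
    exact ⟨n + 1, by rw [hs]; exact hg₃ _ _⟩
  have hneg : ∀ φ, ∀ {Δ : List Fm}, (∀ ψ ∈ Δ, ∃ n, ψ ∈ (s n).1) → Derives T Δ φ →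
      ¬ ∃ n, φ.neg ∈ (s n).1 := by
    intro φ Δ hΔ h hn
    refine hcons (φ.neg :: Δ) ?_ (.impE (φ := φ) (.hyp List.mem_cons_self)
      (h.weaken (List.subset_cons_self _ _)))
    intro ψ hψ
    rcases List.mem_cons.1 hψ with rfl | hψ
    exacts [hn, hΔ ψ hψ]
  refine ⟨{φ | ∃ n, φ ∈ (s n).1}, ⟨?_, ?_, ?_, ?_, ?_⟩, fun φ hφ => ⟨0, hφ⟩⟩
  · intro Δ φ hΔ h
    obtain ⟨n, h1 | h1⟩ := hdec φ
    · exact ⟨n, h1⟩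
    · exact absurd ⟨n, h1.1⟩ (hneg φ hΔ h)
  · intro h
    exact hcons [Fm.bot] (by simpa using h) (.hyp List.mem_cons_self)
  · intro φ
    obtain ⟨n, h1 | h1⟩ := hdec φ
    exacts [Or.inl ⟨n, h1⟩, Or.inr ⟨n, h1.1⟩]
  · intro φ hφ
    obtain ⟨n, h1 | h1⟩ := hdec φ.all
    · exact ⟨n, h1⟩
    · obtain ⟨t, ht⟩ := h1.2.1 φ rfl
      exact absurd ⟨n, ht⟩ (hneg _ (Δ := [φ.inst t]) (by simpa using hφ t)
        (.hyp List.mem_cons_self))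
  · intro φ hφ
    obtain ⟨n, h1 | h1⟩ := hdec φ.allFn
    · exact ⟨n, h1⟩
    · obtain ⟨t, ht⟩ := h1.2.2 φ rfl
      exact absurd ⟨n, ht⟩ (hneg _ (Δ := [φ.instFn t]) (by simpa using hφ t)
        (.hyp List.mem_cons_self))

namespace IsHenkin

variable {T S : Set Fm}

theorem closed₁ (h : IsHenkin T S) {φ ψ : Fm} (hφ : φ ∈ S) (hd : Derives T [φ] ψ) : ψ ∈ S :=
  h.closed (by simpa using hφ) hd

theorem imp_mem (h : IsHenkin T S) (φ ψ : Fm) : φ.imp ψ ∈ S ↔ (φ ∈ S → ψ ∈ S) := by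
  constructor
  · intro h1 h2
    exact h.closed (Γ := [φ.imp ψ, φ]) (by simp [h1, h2])
      (.impE (φ := φ) (.hyp List.mem_cons_self) (.hyp (by simp)))
  · intro h1
    rcases h.total φ with h2 | h2
    · exact h.closed₁ (h1 h2) (.impI (.hyp (by simp)))
    · exact h.closed₁ h2 (.impI (Derives.exFalso (.impE (φ := φ) (.hyp (by simp [Fm.neg]))
        (.hyp List.mem_cons_self))))

theorem all_mem (h : IsHenkin T S) (φ : Fm) : φ.all ∈ S ↔ ∀ t, φ.inst t ∈ S :=
  ⟨fun h1 t => h.closed₁ h1 (.allE t (.hyp List.mem_cons_self)), h.all φ⟩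

theorem allFn_mem (h : IsHenkin T S) (φ : Fm) : φ.allFn ∈ S ↔ ∀ j, φ.instFn j ∈ S :=
  ⟨fun h1 j => h.closed₁ h1 (.allFnE j (.hyp List.mem_cons_self)), h.allFn φ⟩

theorem eq_refl (h : IsHenkin T S) (t : Tm) : Fm.eq t t ∈ S :=
  h.closed (Γ := []) (by simp) (.eqI t)

theorem inst_mem (h : IsHenkin T S) {s t : Tm} (φ : Fm) (hst : Fm.eq s t ∈ S)
    (hs : φ.inst s ∈ S) : φ.inst t ∈ S :=
  h.closed (Γ := [Fm.eq s t, φ.inst s]) (by simp [hst, hs])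
    (.eqE (s := s) (.hyp List.mem_cons_self) (.hyp (by simp)))

theorem shift_subst_cons (s t : Tm) : t.shift.subst id (cons s Tm.var) = t := by
  rw [Tm.shift, Tm.subst_subst]
  exact Tm.subst_var t

/-- Leibniz's rule for the formula `u(s) = u(x)`, with `x` replaced first by `s`, then by `t`. -/
theorem eq_congr (h : IsHenkin T S) {s t : Tm} (u : Tm) (hst : Fm.eq s t ∈ S) :
    Fm.eq (u.subst id (cons s Tm.var)) (u.subst id (cons t Tm.var)) ∈ S := by
  have := h.inst_mem (Fm.eq (u.subst id (cons s Tm.var)).shift u) hst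
  simp only [Fm.inst, Fm.subst, shift_subst_cons] at this
  exact this (h.eq_refl _)

theorem eq_symm (h : IsHenkin T S) {s t : Tm} (hst : Fm.eq s t ∈ S) : Fm.eq t s ∈ S := by
  have := h.inst_mem (Fm.eq (Tm.var 0) s.shift) hst
  simp only [Fm.inst, Fm.subst, shift_subst_cons, Tm.subst, cons_zero] at this
  exact this (h.eq_refl _)

theorem eq_trans (h : IsHenkin T S) {s t u : Tm} (hst : Fm.eq s t ∈ S) (htu : Fm.eq t u ∈ S) :
    Fm.eq s u ∈ S := by
  have := h.inst_mem (Fm.eq s.shift (Tm.var 0)) htu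
  simp only [Fm.inst, Fm.subst, shift_subst_cons, Tm.subst, cons_zero] at this
  exact this hst

theorem eq_congr₂ (h : IsHenkin T S) {s s' t t' : Tm} (op : Tm → Tm → Tm)
    (hop : ∀ ρ σ s t, (op s t).subst ρ σ = op (s.subst ρ σ) (t.subst ρ σ))
    (hs : Fm.eq s s' ∈ S) (ht : Fm.eq t t' ∈ S) : Fm.eq (op s t) (op s' t') ∈ S := by
  have h1 := h.eq_congr (op (Tm.var 0) t.shift) hs
  have h2 := h.eq_congr (op s'.shift (Tm.var 0)) ht
  simp only [hop, shift_subst_cons, Tm.subst, cons_zero] at h1 h2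
  exact h.eq_trans h1 h2

theorem le_congr (h : IsHenkin T S) {s s' t t' : Tm}
    (hs : Fm.eq s s' ∈ S) (ht : Fm.eq t t' ∈ S) (hst : Fm.le s t ∈ S) : Fm.le s' t' ∈ S := by
  have h1 := h.inst_mem (Fm.le (Tm.var 0) t.shift) hs
  have h2 := h.inst_mem (Fm.le s'.shift (Tm.var 0)) ht
  simp only [Fm.inst, Fm.subst, shift_subst_cons, Tm.subst, cons_zero] at h1 h2
  exact h2 (h1 hst)

/-- Equality of terms according to a Henkin set. -/
def setoid (h : IsHenkin T S) : Setoid Tm where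
  r s t := Fm.eq s t ∈ S
  iseqv := ⟨h.eq_refl, h.eq_symm, h.eq_trans⟩

/-- The term model of a Henkin set. -/
def model (h : IsHenkin T S) : Model where
  Num := Quotient h.setoid
  Fn := ℕ
  zero := Quotient.mk _ Tm.zero
  one := Quotient.mk _ Tm.one
  add := Quotient.map₂ Tm.add fun _ _ h₁ _ _ h₂ =>
    h.eq_congr₂ Tm.add (fun _ _ _ _ => rfl) h₁ h₂
  mul := Quotient.map₂ Tm.mul fun _ _ h₁ _ _ h₂ =>
    h.eq_congr₂ Tm.mul (fun _ _ _ _ => rfl) h₁ h₂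
  len := Quotient.map Tm.len fun _ _ h₁ => h.eq_congr (Tm.len (Tm.var 0)) h₁
  half := Quotient.map Tm.half fun _ _ h₁ => h.eq_congr (Tm.half (Tm.var 0)) h₁
  smash := Quotient.map₂ Tm.smash fun _ _ h₁ _ _ h₂ =>
    h.eq_congr₂ Tm.smash (fun _ _ _ _ => rfl) h₁ h₂
  msp := Quotient.map₂ Tm.msp fun _ _ h₁ _ _ h₂ =>
    h.eq_congr₂ Tm.msp (fun _ _ _ _ => rfl) h₁ h₂
  ap j := Quotient.map (Tm.ap j) fun _ _ h₁ => h.eq_congr (Tm.ap j (Tm.var 0)) h₁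
  le := Quotient.lift₂ (fun s t => Fm.le s t ∈ S) fun _ _ _ _ h₁ h₂ =>
    propext ⟨h.le_congr h₁ h₂, h.le_congr (h.eq_symm h₁) (h.eq_symm h₂)⟩

/-- The value of a term in the term model under the identical assignment. -/
def cls (h : IsHenkin T S) (t : Tm) : h.model.Num := Quotient.mk h.setoid t

theorem cls_surjective (h : IsHenkin T S) : Function.Surjective h.cls := Quotient.exists_rep

theorem val_model (h : IsHenkin T S) (ρ : ℕ → ℕ) (σ : ℕ → Tm) (t : Tm) :
    t.val h.model ρ (fun i => h.cls (σ i)) =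
      h.cls (t.subst ρ σ) := by
  induction t <;> simp_all [Tm.val, Tm.subst] <;> rfl

/-- The truth lemma. It is stated for all `ρ` and `σ` because the quantifier steps change the
assignment; every element of the model is the class of a term. -/
theorem sat_model (h : IsHenkin T S) (ρ : ℕ → ℕ) (σ : ℕ → Tm) (φ : Fm) :
    φ.Sat h.model ρ (fun i => h.cls (σ i)) ↔ φ.subst ρ σ ∈ S := by
  induction φ generalizing ρ σ with
  | bot => exact ⟨False.elim, h.bot⟩
  | eq s t =>
    simp only [Fm.Sat, val_model, Fm.subst]
    exact Quotient.eq (r := h.setoid)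
  | le s t =>
    simp only [Fm.Sat, val_model, Fm.subst]
    rfl
  | imp φ ψ h₁ h₂ => simp only [Fm.Sat, h₁, h₂, Fm.subst, h.imp_mem]
  | all φ ih =>
    rw [Fm.subst_all, h.all_mem]
    simp only [Fm.inst_subst, ← ih]
    refine ⟨fun h1 t => ?_, fun h1 a => ?_⟩
    · rw [comp_cons]
      exact h1 (h.cls t)
    · obtain ⟨t, rfl⟩ := h.cls_surjective a
      have := h1 t
      rwa [comp_cons] at this
  | allFn φ ih =>
    rw [Fm.subst_allFn, h.allFn_mem]
    simp only [Fm.instFn_subst, ← ih]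
    rfl

theorem model_satisfies (h : IsHenkin T S) : h.model.Satisfies T := by
  intro φ hφ ρ v
  choose σ hσ using fun i => h.cls_surjective (v i)
  obtain rfl : (fun i => h.cls (σ i)) = v := funext hσ
  refine (h.sat_model ρ σ φ).2 ?_
  exact h.closed (Γ := []) (by simp) (Derives.subst_nil ρ σ (.ax hφ))

end IsHenkin

/-- Gödel's completeness theorem. -/
theorem derives_of_forall_model {T : Set Fm} {φ : Fm}
    (h : ∀ A : Model, A.Satisfies T → ∀ f v, φ.Sat A f v) : Derives T [] φ := by
  by_contra hφ
  obtain ⟨S, hS, hmem⟩ := exists_isHenkin (T := T) (Γ := [φ.neg]) fun h' => hφ (.contra h')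
  have h1 := h _ hS.model_satisfies id fun i => hS.cls (Tm.var i)
  rw [hS.sat_model, Fm.subst_var] at h1
  exact hS.bot ((hS.imp_mem φ Fm.bot).1 (hmem φ.neg (by simp)) h1)

/-! ### Semantics of the defined notions -/

section

variable {α : Type} (a : α) (v : ℕ → α)

@[simp] theorem cons_one : cons a v 1 = v 0 := rfl
@[simp] theorem cons_two : cons a v 2 = v 1 := rfl
@[simp] theorem cons_three : cons a v 3 = v 2 := rfl
@[simp] theorem cons_four : cons a v 4 = v 3 := rfl

end

namespace Model

variable (A : Model)

instance : Zero A.Num := ⟨A.zero⟩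
instance : One A.Num := ⟨A.one⟩
instance : Add A.Num := ⟨A.add⟩
instance : Mul A.Num := ⟨A.mul⟩
instance : LE A.Num := ⟨A.le⟩

end Model

section

variable {A : Model} (f : ℕ → A.Fn) (v : ℕ → A.Num)

@[simp] theorem Tm.val_var (i : ℕ) : (Tm.var i).val A f v = v i := rfl
@[simp] theorem Tm.val_zero : (0 : Tm).val A f v = 0 := rfl
@[simp] theorem Tm.val_one : (1 : Tm).val A f v = 1 := rfl
@[simp] theorem Tm.val_add (s t : Tm) : (s + t).val A f v = s.val A f v + t.val A f v := rfl
@[simp] theorem Tm.val_mul (s t : Tm) : (s * t).val A f v = s.val A f v * t.val A f v := rfl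
@[simp] theorem Tm.val_len (t : Tm) : (len t).val A f v = A.len (t.val A f v) := rfl
@[simp] theorem Tm.val_half (t : Tm) : (half t).val A f v = A.half (t.val A f v) := rfl
@[simp] theorem Tm.val_smash (s t : Tm) :
    (smash s t).val A f v = A.smash (s.val A f v) (t.val A f v) := rfl
@[simp] theorem Tm.val_msp (s t : Tm) :
    (msp s t).val A f v = A.msp (s.val A f v) (t.val A f v) := rfl
@[simp] theorem Tm.val_ap (j : ℕ) (t : Tm) : (ap j t).val A f v = A.ap (f j) (t.val A f v) := rfl

@[simp] theorem Fm.sat_eq (s t : Tm) : (eq s t).Sat A f v ↔ s.val A f v = t.val A f v := Iff.rfl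
@[simp] theorem Fm.sat_le (s t : Tm) : (le s t).Sat A f v ↔ s.val A f v ≤ t.val A f v := Iff.rfl
@[simp] theorem Fm.sat_imp (φ ψ : Fm) : (imp φ ψ).Sat A f v ↔ (φ.Sat A f v → ψ.Sat A f v) :=
  Iff.rfl
@[simp] theorem Fm.sat_all (φ : Fm) : φ.all.Sat A f v ↔ ∀ a, φ.Sat A f (cons a v) := Iff.rfl
@[simp] theorem Fm.sat_neg (φ : Fm) : φ.neg.Sat A f v ↔ ¬ φ.Sat A f v := Iff.rfl
@[simp] theorem Fm.sat_and (φ ψ : Fm) : (φ.and ψ).Sat A f v ↔ φ.Sat A f v ∧ ψ.Sat A f v := by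
  simp [Fm.and]
@[simp] theorem Fm.sat_or (φ ψ : Fm) : (φ.or ψ).Sat A f v ↔ φ.Sat A f v ∨ ψ.Sat A f v := by
  simp [Fm.or, or_iff_not_imp_left]
@[simp] theorem Fm.sat_iff (φ ψ : Fm) : (φ.iff ψ).Sat A f v ↔ (φ.Sat A f v ↔ ψ.Sat A f v) := by
  simp [Fm.iff, iff_iff_implies_and_implies]
@[simp] theorem Fm.sat_ex (φ : Fm) : φ.ex.Sat A f v ↔ ∃ a, φ.Sat A f (cons a v) := by
  simp [Fm.ex]
@[simp] theorem Fm.sat_ball (t : Tm) (φ : Fm) :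
    (ball t φ).Sat A f v ↔ ∀ a ≤ t.val A f v, φ.Sat A f (cons a v) := by
  simp [Fm.ball, Tm.val_shift]
@[simp] theorem Fm.sat_bex (t : Tm) (φ : Fm) :
    (bex t φ).Sat A f v ↔ ∃ a ≤ t.val A f v, φ.Sat A f (cons a v) := by
  simp [Fm.bex]

theorem Fm.sat_exUnique (φ : Fm) : φ.exUnique.Sat A f v ↔ ∃! a, φ.Sat A f (cons a v) := by
  simp only [Fm.exUnique, sat_ex, sat_and, sat_all, sat_imp, Fm.sat_subst, sat_eq, comp_cons,
    Tm.val_var, cons_zero, cons_succ, id]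
  rfl

theorem Fm.sat_alls_of_forall {φ : Fm} (h : ∀ v, φ.Sat A f v) (l : ℕ) (v : ℕ → A.Num) :
    (Fm.alls l φ).Sat A f v := by
  induction l generalizing v with
  | zero => exact h v
  | succ l ih => exact fun a => ih _

theorem Fm.sat_allFns_of_forall {φ : Fm} (h : ∀ f v, φ.Sat A f v) (k : ℕ) (f : ℕ → A.Fn)
    (v : ℕ → A.Num) : (Fm.allFns k φ).Sat A f v := by
  induction k generalizing f with
  | zero => exact h f v
  | succ l ih => exact fun a => ih _

end

theorem Tm.shift_subst (ρ : ℕ → ℕ) (σ : ℕ → Tm) (t : Tm) :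
    t.shift.subst ρ (liftN σ) = (t.subst ρ σ).shift := by
  simp [Tm.shift, Tm.subst_subst, Tm.subst, liftN]

theorem Fm.subst_ball (ρ : ℕ → ℕ) (σ : ℕ → Tm) (t : Tm) (φ : Fm) :
    (Fm.ball t φ).subst ρ σ = Fm.ball (t.subst ρ σ) (φ.subst ρ (liftN σ)) := by
  rw [Fm.ball, Fm.subst_all, Fm.subst, Fm.subst, Tm.shift_subst]
  rfl

theorem IsB1.subst {b : Bool} {φ : Fm} (h : IsB1 b φ) (ρ : ℕ → ℕ) (σ : ℕ → Tm) :
    IsB1 b (φ.subst ρ σ) := by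
  induction h generalizing σ with
  | bot b => exact .bot b
  | eq b s t => exact .eq b _ _
  | le b s t => exact .le b _ _
  | imp _ _ ih ih' => exact .imp (ih σ) (ih' σ)
  | sball t _ ih =>
    rw [Fm.subst_ball]
    exact .sball _ (ih _)
  | ball t _ ih =>
    rw [Fm.subst_ball]
    exact .ball _ (ih _)

/-! ### Arithmetic in models of `S^1_2` -/

/-- Models of `S^1_2` (with a distinguished function). -/
structure S12Model extends Model where
  fn : Fn
  sat : toModel.Satisfies S12

namespace S12Model

variable (A : S12Model)

/-- Axioms are addressed by their position in `basicAxioms`, counted from 0; `x`, `y`, `z`, `u`, `w`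
are the values of the variables 0 to 4. -/
theorem basic (i : ℕ) (hi : i < 36) (x y z u w : A.Num) :
    (basicAxioms[i]'hi).Sat A.toModel (fun _ => A.fn)
      (cons x (cons y (cons z (cons u (cons w fun _ => 0))))) :=
  A.sat _ (Or.inl (List.getElem_mem _)) _ _

/-- The interface to PIND: any property of numbers expressed by a Σ^b_1 formula with parameters `f`,
`v` may be used. -/
theorem pind {φ : Fm} (hφ : IsB1 true φ) (f : ℕ → A.Fn) (v : ℕ → A.Num) {P : A.Num → Prop}
    (hP : ∀ a, P a ↔ φ.Sat A.toModel f (cons a v)) (h0 : P 0)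
    (hs : ∀ a, P (A.half a) → P a) (a : A.Num) : P a := by
  have h := A.sat (BFF.pind φ) (Or.inr ⟨φ, hφ, rfl⟩) f v
  simp only [BFF.pind, Fm.inst, Fm.sat_imp, Fm.sat_and, Fm.sat_all, Fm.sat_subst, comp_cons,
    Tm.val_zero, Tm.val_half, Tm.val_var, cons_zero, cons_succ, id, ← hP] at h
  exact h ⟨h0, hs⟩ a

variable {A}

theorem lt_iff' (x y : A.Num) : x ≤ y ∧ x ≠ y ↔ x + 1 ≤ y := by
  simpa [basicAxioms] using A.basic 3 (by norm_num) x y 0 0 0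

theorem add_comm' (x y : A.Num) : x + y = y + x := by
  simpa [basicAxioms] using A.basic 20 (by norm_num) x y 0 0 0

theorem add_zero' (x : A.Num) : x + 0 = x := by
  simpa [basicAxioms] using A.basic 21 (by norm_num) x 0 0 0 0

theorem add_assoc' (x y z : A.Num) : x + y + z = x + (y + z) := by
  simpa [basicAxioms] using A.basic 23 (by norm_num) x y z 0 0

theorem mul_zero' (x : A.Num) : x * 0 = 0 := by
  simpa [basicAxioms] using A.basic 25 (by norm_num) x 0 0 0 0

theorem mul_succ' (x y : A.Num) : x * (y + 1) = x * y + x := by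
  simpa [basicAxioms] using A.basic 26 (by norm_num) x y 0 0 0

theorem mul_comm' (x y : A.Num) : x * y = y * x := by
  simpa [basicAxioms] using A.basic 27 (by norm_num) x y 0 0 0

theorem mul_add' (x y z : A.Num) : x * (y + z) = x * y + x * z := by
  simpa [basicAxioms] using A.basic 28 (by norm_num) x y z 0 0

theorem half_iff' (x y : A.Num) : x = A.half y ↔ (1 + 1) * x = y ∨ (1 + 1) * x + 1 = y := by
  simpa [basicAxioms] using A.basic 31 (by norm_num) x y 0 0 0

theorem mul_one' (x : A.Num) : x * 1 = x := by
  have h := mul_succ' x 0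
  rwa [mul_zero', add_comm' 0 1, add_zero', add_comm' 0 x, add_zero'] at h

theorem half_cases' (x : A.Num) :
    A.half x + A.half x = x ∨ A.half x + A.half x + 1 = x := by
  have h := (half_iff' (A.half x) x).1 rfl
  rwa [mul_comm', mul_add', mul_one'] at h

/-- Not an axiom of BASIC. PIND on the last factor reduces it to distributivity over `z = c + c` or
`z = c + c + 1`. -/
theorem mul_assoc' (x y z : A.Num) : x * y * z = x * (y * z) := by
  refine A.pind (φ := .eq (.var 1 * .var 2 * .var 0) (.var 1 * (.var 2 * .var 0))) (.eq _ _ _)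
    (fun _ => A.fn) (cons x (cons y fun _ => 0)) (P := fun z => x * y * z = x * (y * z)) (by simp)
    (by simp only [mul_zero']) ?_ z
  intro a ha
  rcases half_cases' a with h | h <;> rw [← h] <;>
  simp only [mul_add', ha, mul_one']

instance : CommSemiring A.Num where
  add_assoc := add_assoc'
  zero_add x := by rw [add_comm', add_zero']
  add_zero := add_zero'
  add_comm := add_comm'
  nsmul := nsmulRec
  left_distrib := mul_add'
  right_distrib x y z := by rw [mul_comm', mul_add', mul_comm' z x, mul_comm' z y]
  zero_mul x := by rw [mul_comm', mul_zero']
  mul_zero := mul_zero'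
  mul_assoc := mul_assoc'
  one_mul x := by rw [mul_comm', mul_one']
  mul_one := mul_one'
  mul_comm := mul_comm'

noncomputable instance : LinearOrder A.Num where
  le_refl x := by simpa [basicAxioms] using A.basic 5 (by norm_num) x x 0 0 0
  le_trans x y z h h' := by
    have := A.basic 7 (by norm_num) x y z 0 0
    simp [basicAxioms] at this
    exact this h h'
  le_antisymm x y h h' := by
    have := A.basic 6 (by norm_num) x y 0 0 0
    simp [basicAxioms] at this
    exact this h h'
  le_total x y := by
    have := A.basic 5 (by norm_num) y x 0 0 0
    simpa [basicAxioms] using this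
  toDecidableLE := Classical.decRel _

theorem add_one_le_iff (x y : A.Num) : x + 1 ≤ y ↔ x < y := by
  rw [← lt_iff', lt_iff_le_and_ne]

theorem zero_le (x : A.Num) : 0 ≤ x := by
  simpa [basicAxioms] using A.basic 2 (by norm_num) x 0 0 0 0

theorem add_le_add_iff (x y z : A.Num) : x + y ≤ x + z ↔ y ≤ z := by
  simpa [basicAxioms] using A.basic 24 (by norm_num) x y z 0 0

theorem mul_le_mul_iff (x y z : A.Num) (hx : 1 ≤ x) : x * y ≤ x * z ↔ y ≤ z := by
  have := A.basic 29 (by norm_num) x y z 0 0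
  simp [basicAxioms] at this
  exact this hx

theorem zero_ne_one' : (0 : A.Num) ≠ 1 := by
  have := A.basic 1 (by norm_num) 0 0 0 0 0
  simpa [basicAxioms] using this

theorem one_le_iff (x : A.Num) : 1 ≤ x ↔ 0 < x := by
  rw [← add_one_le_iff, zero_add]

instance : IsStrictOrderedRing A.Num where
  add_le_add_left x y h z := by rwa [add_comm x, add_comm y, add_le_add_iff]
  le_of_add_le_add_left x y z h := (add_le_add_iff x y z).1 h
  zero_le_one := zero_le 1
  exists_pair_ne := ⟨0, 1, zero_ne_one'⟩
  mul_lt_mul_of_pos_left x hx y z h := by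
    rw [lt_iff_not_ge, mul_le_mul_iff _ _ _ ((one_le_iff x).2 hx), not_le]
    exact h
  mul_lt_mul_of_pos_right x hx y z h := by
    rw [lt_iff_not_ge, mul_comm z, mul_comm y, mul_le_mul_iff _ _ _ ((one_le_iff x).2 hx), not_le]
    exact h

end S12Model

/-! ### Powers of two, subtraction and induction on lengths -/

namespace S12Model

variable {A : S12Model}

theorem zero_lt_one' : (0 : A.Num) < 1 := zero_lt_one

theorem half_cases (x : A.Num) :
    x = A.half x + A.half x ∨ x = A.half x + A.half x + 1 := by
  have := half_cases' x
  grind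

theorem half_unique {x y : A.Num} (h : x + x = y ∨ x + x + 1 = y) : A.half y = x := by
  refine ((half_iff' x y).2 ?_).symm
  rwa [add_mul, one_mul]

theorem half_zero : A.half 0 = (0 : A.Num) := half_unique (by simp)

theorem len_zero : A.len 0 = (0 : A.Num) := by
  simpa [basicAxioms] using A.basic 8 (by norm_num) 0 0 0 0 0

theorem len_one : A.len 1 = (1 : A.Num) := by
  simpa [basicAxioms] using A.basic 10 (by norm_num) 0 0 0 0 0

theorem len_eq_half_add_one {x : A.Num} (h : x ≠ 0) : A.len x = A.len (A.half x) + 1 := by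
  have := A.basic 30 (by norm_num) x 0 0 0 0
  simp [basicAxioms] at this
  exact this h

theorem len_smash (x y : A.Num) : A.len (A.smash x y) = A.len x * A.len y + 1 := by
  simpa [basicAxioms] using A.basic 12 (by norm_num) x y 0 0 0

theorem zero_smash (y : A.Num) : A.smash 0 y = 1 := by
  simpa [basicAxioms] using A.basic 13 (by norm_num) 0 y 0 0 0

theorem smash_comm (x y : A.Num) : A.smash x y = A.smash y x := by
  simpa [basicAxioms] using A.basic 15 (by norm_num) x y 0 0 0

theorem smash_mul {x u v : A.Num} (h : A.len x = A.len u + A.len v) (y : A.Num) :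
    A.smash x y = A.smash u y * A.smash v y := by
  have := A.basic 17 (by norm_num) x y 0 u v
  simp [basicAxioms] at this
  exact this h

/-- Both 2 # 1 = 2(1 # 1) and, as |2| = |1| + |1|, 2 # 1 = (1 # 1)². The factor 1 # 1 can be
cancelled: it is not 0, its length being |1||1| + 1. -/
theorem one_smash_one : A.smash 1 1 = (1 + 1 : A.Num) := by
  have h := (A.basic 14 (by norm_num) 1 0 0 0 0)
  simp [basicAxioms] at h
  have h1 : A.len (1 + 1) = A.len 1 + A.len (1 : A.Num) := by
    have := A.basic 9 (by norm_num) 1 0 0 0 0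
    simp [basicAxioms] at this
    rw [this.1, len_one]
  have h2 := smash_mul h1 1
  rw [smash_comm, h.1] at h2
  have h3 : A.smash 1 1 ≠ (0 : A.Num) := by
    intro h3
    have := len_smash (A := A) 1 1
    rw [h3, len_zero, len_one, one_mul] at this
    have h01 := A.zero_lt_one'
    grind
  have h4 := (one_le_iff _).2 (lt_of_le_of_ne (zero_le _) (Ne.symm h3))
  rw [mul_comm] at h2
  exact le_antisymm ((mul_le_mul_iff _ _ _ h4).1 h2.ge) ((mul_le_mul_iff _ _ _ h4).1 h2.le)

theorem smash_pos (x y : A.Num) : 0 < A.smash x y := by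
  refine lt_of_le_of_ne (zero_le _) fun h => ?_
  have h1 := len_smash x y
  rw [← h, len_zero] at h1
  have h2 := mul_nonneg (zero_le (A.len x)) (zero_le (A.len y))
  have h01 := A.zero_lt_one'
  grind

theorem smash_half {x : A.Num} (h : x ≠ 0) (k : A.Num) :
    A.smash x k = A.smash (A.half x) k * A.smash 1 k :=
  smash_mul (by rw [len_eq_half_add_one h, len_one]) k

theorem one_smash_half {x : A.Num} (h : x ≠ 0) : A.smash 1 x = A.smash 1 (A.half x) + A.smash 1 (A.half x) := by
  rw [smash_comm, smash_half h, one_smash_one, smash_comm, mul_add, mul_one]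

theorem one_smash_zero : A.smash 1 0 = (1 : A.Num) := by rw [smash_comm, zero_smash]

/-- By `one_smash_half`, 1 # x behaves like 2^|x|: it doubles whenever a bit is appended to a number
that does not vanish or to 0 a bit 1. -/
theorem lt_one_smash (x : A.Num) : x < A.smash 1 x := by
  rw [← add_one_le_iff]
  refine A.pind (φ := .le (.var 0 + 1) (.smash 1 (.var 0))) (.le _ _ _) (fun _ => A.fn)
    (fun _ => 0) (P := fun x => x + 1 ≤ A.smash 1 x) (by simp)
    (by simp [one_smash_zero]) ?_ x
  intro a ha
  by_cases h : a = 0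
  · rw [h, one_smash_zero, zero_add]
  · have h01 := A.zero_lt_one'
    rw [one_smash_half h]
    rcases half_cases a with h | h <;> grind

/-- BASIC has no subtraction. PIND on `c` computes the difference modulo 1 # c bit by bit: there is
`z < 1 # c` congruent to `y - x`, where the congruence is expressed by multiples `a`, `b` on the two
sides. For `c = y` the modulus exceeds `y`, which forces `a = b`. -/
theorem exists_add_of_le {x y : A.Num} (hxy : x ≤ y) : ∃ z, y = x + z := by
  have key := A.pind
    (φ := .bex (.smash 1 (.var 0)) (.and (.le (.var 0 + 1) (.smash 1 (.var 1)))
      (.bex (.var 3) (.bex (.var 3) (.eq (.var 4 + .var 2 + .var 1 * .smash 1 (.var 3))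
        (.var 5 + .var 0 * .smash 1 (.var 3)))))))
    (.bex _ (.and (.le _ _ _) (.bex _ (.bex _ (.eq _ _ _))))) (fun _ => A.fn)
    (cons x (cons y fun _ => 0))
    (P := fun c => ∃ z ≤ A.smash 1 c, z + 1 ≤ A.smash 1 c ∧ ∃ a ≤ y, ∃ b ≤ x,
      x + z + a * A.smash 1 c = y + b * A.smash 1 c) (by simp)
    ⟨0, zero_le _, by simp [one_smash_zero], y, le_rfl, x, le_rfl,
      by simp [one_smash_zero, add_comm]⟩ ?_ y
  · obtain ⟨z, -, hz, a, -, b, -, h⟩ := key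
    have hy := lt_one_smash y
    have hx0 := zero_le x
    set p := A.smash 1 y
    have hz' := zero_le z
    have h01 := A.zero_lt_one'
    rcases lt_trichotomy a b with hab | rfl | hab
    · have h1 := mul_le_mul_of_nonneg_right ((add_one_le_iff _ _).2 hab) (zero_le p)
      rw [add_mul, one_mul] at h1
      grind
    · exact ⟨z, by grind⟩
    · have h1 := mul_le_mul_of_nonneg_right ((add_one_le_iff _ _).2 hab) (zero_le p)
      rw [add_mul, one_mul] at h1
      grind
  · rintro c ⟨z, hz, hz', a, ha, b, hb, h⟩
    by_cases hc : c = 0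
    · subst hc
      rw [half_zero] at *
      exact ⟨z, hz, hz', a, ha, b, hb, h⟩
    rw [one_smash_half hc]
    set p := A.smash 1 (A.half c)
    have ha0 := zero_le (A.half a)
    have hb0 := zero_le (A.half b)
    have hz0 := zero_le z
    have h01 := A.zero_lt_one'
    have hp : 0 < p := smash_pos _ _
    -- The modulus doubles, so `a` and `b` are halved. If their parities differ, the next bit of the
    -- difference is 1, i.e. `p` is added to `z`.
    rcases half_cases a with h1 | h1 <;> rcases half_cases b with h2 | h2
    · exact ⟨z, by grind, by grind, A.half a, by grind, A.half b, by grind, by grind⟩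
    · exact ⟨z + p, by grind, by grind, A.half a, by grind, A.half b + 1, by grind, by grind⟩
    · exact ⟨z + p, by grind, by grind, A.half a, by grind, A.half b, by grind, by grind⟩
    · exact ⟨z, by grind, by grind, A.half a, by grind, A.half b, by grind, by grind⟩

/-- Induction up to the length of a number. -/
theorem lind {φ : Fm} (hφ : IsB1 true φ) (f : ℕ → A.Fn) (v : ℕ → A.Num) {P : A.Num → Prop}
    (hP : ∀ a, P a ↔ φ.Sat A.toModel f (cons a v)) (h0 : P 0)
    (hs : ∀ i, P i → P (i + 1)) {y i : A.Num} (hi : i ≤ A.len y) : P i := by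
  -- PIND on `c` lets |c| run through the lengths up to |y|. The second conjunct freezes the
  -- statement at `i` once |c| has passed `i`, so that no number of length exactly `i` has to be
  -- available. The premises are atomic, so the formula stays Σ^b_1.
  have key := A.pind
    (φ := .and (.imp (.le (.len (.var 0)) (.var 1))
        (φ.subst id (cons (.len (.var 0)) fun j => .var (j + 2))))
      (.imp (.le (.var 1) (.len (.var 0))) (φ.subst id (cons (.var 1) fun j => .var (j + 2)))))
    ?_ f (cons i v) (P := fun c => (A.len c ≤ i → P (A.len c)) ∧ (i ≤ A.len c → P i))
    ?_ ?_ ?_ y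
  · exact key.2 hi
  · exact .and (.imp (.le _ _ _) (hφ.subst _ _)) (.imp (.le _ _ _) (hφ.subst _ _))
  · intro a
    simp [Fm.sat_subst, comp_cons, hP]
  · rw [len_zero]
    refine ⟨fun _ => h0, fun h => ?_⟩
    rwa [le_antisymm h (zero_le i)]
  · rintro c ⟨h1, h2⟩
    by_cases hc : c = 0
    · subst hc
      rw [half_zero] at *
      exact ⟨h1, h2⟩
    have h01 := A.zero_lt_one'
    rw [len_eq_half_add_one hc]
    have h3 : A.len (A.half c) + 1 ≤ i → P (A.len (A.half c) + 1) := fun h =>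
      hs _ (h1 (by grind))
    refine ⟨h3, fun h => ?_⟩
    rcases h.lt_or_eq with h | h
    · refine h2 ?_
      by_contra h'
      have := (add_one_le_iff _ _).2 (not_le.1 h')
      grind
    · rw [h]
      exact h3 h.ge

/-! ### Most significant bits and monotonicity of `#` -/

theorem msp_zero (x : A.Num) : A.msp x 0 = 0 := by
  simpa [basicAxioms] using A.basic 32 (by norm_num) x 0 0 0 0

theorem msp_eq_half {x y : A.Num} (h : y < A.len x) : A.msp x y = A.half (A.msp x (y + 1)) := by
  have := A.basic 34 (by norm_num) x y 0 0 0
  simp [basicAxioms] at this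
  exact this ((add_one_le_iff _ _).2 h)

theorem msp_of_le {x y : A.Num} (h : A.len x ≤ y) : A.msp x y = x := by
  have := A.basic 35 (by norm_num) x y 0 0 0
  simp [basicAxioms] at this
  exact this h

/-- The axioms obtain the prefix of length `m` from that of length `m + 1`, so the induction
descends from |x|. It is run upwards on the number `j` of bits removed, with `i + j = |x|`. -/
theorem len_msp {x i : A.Num} (hi : i ≤ A.len x) : A.len (A.msp x i) = i := by
  obtain ⟨d, hd⟩ := exists_add_of_le hi
  have hd' : d ≤ A.len x := by have := zero_le i; grind
  have := A.lind
    (φ := .imp (.le (.var 0) (.len (.var 1))) (.bex (.len (.var 1))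
      (.and (.eq (.var 0 + .var 1) (.len (.var 2))) (.eq (.len (.msp (.var 2) (.var 0))) (.var 0)))))
    (.imp (.le _ _ _) (.bex _ (.and (.eq _ _ _) (.eq _ _ _)))) (fun _ => A.fn)
    (cons x fun _ => 0)
    (P := fun j => j ≤ A.len x → ∃ i ≤ A.len x, i + j = A.len x ∧ A.len (A.msp x i) = i) (by simp)
    (fun _ => ⟨A.len x, le_rfl, add_zero _, by rw [msp_of_le le_rfl]⟩) ?_ hd' hd'
  · obtain ⟨j, -, h1, h2⟩ := this
    obtain rfl : j = i := by grind
    exact h2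
  · intro j ih hj
    have h01 := A.zero_lt_one'
    obtain ⟨i, hi, h1, h2⟩ := ih (by grind)
    obtain ⟨m, rfl⟩ : ∃ m, i = 1 + m := exists_add_of_le (by grind)
    have hm : m < A.len x := by have := zero_le j; grind
    refine ⟨m, hm.le, by grind, ?_⟩
    rw [add_comm 1 m] at h2
    rw [msp_eq_half hm]
    rw [len_eq_half_add_one] at h2
    · grind
    · intro h
      rw [h, len_zero] at h2
      have := zero_le m
      grind

theorem len_msp_le (x i : A.Num) : A.len (A.msp x i) ≤ i := by
  rcases le_total i (A.len x) with h | h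
  · rw [len_msp h]
  · rwa [msp_of_le h]

theorem msp_add_one {x i : A.Num} (hi : i + 1 ≤ A.len x) (k : A.Num) :
    A.smash (A.msp x (i + 1)) k = A.smash (A.msp x i) k * A.smash 1 k :=
  smash_mul (by
    rw [len_msp hi, len_msp ((le_of_lt (lt_add_of_pos_right i zero_lt_one)).trans hi), len_one]) k

/-- The cofactor comes from a number of length |b| - |a|; a prefix of `b` supplies one. -/
theorem exists_smash_eq_mul {a b : A.Num} (h : A.len a ≤ A.len b) (k : A.Num) :
    ∃ c, A.smash b k = A.smash a k * A.smash c k := by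
  obtain ⟨d, hd⟩ := exists_add_of_le h
  refine ⟨A.msp b d, smash_mul ?_ k⟩
  rw [len_msp, hd]
  have := zero_le (A.len a)
  grind

theorem le_mul_of_pos {a b : A.Num} (hb : 0 < b) : a ≤ a * b := by
  have h1 := mul_le_mul_of_nonneg_left ((one_le_iff b).2 hb) (zero_le a)
  rwa [mul_one] at h1

theorem smash_mono_left {a b : A.Num} (h : A.len a ≤ A.len b) (k : A.Num) :
    A.smash a k ≤ A.smash b k := by
  obtain ⟨c, hc⟩ := exists_smash_eq_mul h k
  rw [hc]
  exact le_mul_of_pos (smash_pos c k)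

theorem lt_one_smash_of_len_le {e k : A.Num} (h : A.len e ≤ A.len k) : e < A.smash 1 k := by
  refine (lt_one_smash e).trans_le ?_
  rw [smash_comm, smash_comm 1 k]
  exact smash_mono_left h 1

/-! ### Division with remainder and digits -/

theorem exists_div (x : A.Num) {d : A.Num} (hd : 0 < d) :
    ∃ q ≤ x, ∃ r ≤ x, x = q * d + r ∧ r < d := by
  have := A.pind
    (φ := .bex (.var 0) (.bex (.var 1) (.and (.eq (.var 2) (.var 1 * .var 3 + .var 0))
      (.le (.var 0 + 1) (.var 3)))))
    (.bex _ (.bex _ (.and (.eq _ _ _) (.le _ _ _)))) (fun _ => A.fn)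
    (cons d fun _ => 0)
    (P := fun x => ∃ q ≤ x, ∃ r ≤ x, x = q * d + r ∧ r + 1 ≤ d) (by simp)
    ⟨0, le_rfl, 0, le_rfl, by simp, by rw [add_one_le_iff]; exact hd⟩ ?_ x
  · simpa only [add_one_le_iff] using this
  · rintro a ⟨q, hq, r, hr, h, hrd⟩
    have h0 := zero_le (A.half a)
    have hqd := mul_nonneg (zero_le q) (zero_le d)
    have hq0 := zero_le q
    have hr0 := zero_le r
    have h01 := A.zero_lt_one'
    -- Doubling the division of ⌊a/2⌋ leaves a remainder `s < 2d`, so `d` has to be subtracted at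
    -- most once.
    obtain ⟨s, hs, hs1⟩ : ∃ s, a = q * d + q * d + s ∧ s + 1 ≤ d + d := by
      rcases half_cases a with h1 | h1
      · exact ⟨r + r, by grind, by grind⟩
      · exact ⟨r + r + 1, by grind, by grind⟩
    have hs0 : 0 ≤ s := zero_le s
    have hqa : q ≤ q * d := le_mul_of_pos hd
    rcases le_or_gt (s + 1) d with h2 | h2
    · exact ⟨q + q, by grind, s, by grind, by rw [hs, add_mul], h2⟩
    · have hds : d ≤ s := by
        rw [← add_one_le_iff] at h2
        grind
      obtain ⟨t, rfl⟩ := exists_add_of_le hds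
      rw [← add_one_le_iff] at hd
      exact ⟨q + q + 1, by grind, t, by grind, by rw [hs]; ring, by grind⟩

theorem div_unique {q q' r r' d : A.Num} (h : q * d + r = q' * d + r') (hr : r < d)
    (hr' : r' < d) : q = q' ∧ r = r' := by
  have h0 := zero_le r
  have h0' := zero_le r'
  rcases lt_trichotomy q q' with hq | rfl | hq
  · have h1 := mul_le_mul_of_nonneg_right ((add_one_le_iff _ _).2 hq) (zero_le d)
    rw [add_mul, one_mul] at h1
    grind
  · exact ⟨rfl, by grind⟩
  · have h1 := mul_le_mul_of_nonneg_right ((add_one_le_iff _ _).2 hq) (zero_le d)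
    rw [add_mul, one_mul] at h1
    grind

/-- `e` is the digit of `w` in base `q` at the position with weight `p`. -/
def Digit (w p q e : A.Num) : Prop :=
  ∃ a ≤ w, ∃ b ≤ w, w = (a * q + e) * p + b ∧ b + 1 ≤ p ∧ e + 1 ≤ q

theorem exists_digit (w : A.Num) {p q : A.Num} (hp : 0 < p) (hq : 0 < q) :
    ∃ e ≤ w, Digit w p q e := by
  obtain ⟨c, hc, b, hb, h, hbp⟩ := exists_div w hp
  obtain ⟨a, ha, e, he, rfl, heq⟩ := exists_div c hq
  exact ⟨e, he.trans hc, a, ha.trans hc, b, hb, h, (add_one_le_iff _ _).2 hbp,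
    (add_one_le_iff _ _).2 heq⟩

theorem Digit.unique {w p q e e' : A.Num} (h : Digit w p q e) (h' : Digit w p q e') : e = e' := by
  obtain ⟨a, -, b, -, h1, h2, h3⟩ := h
  obtain ⟨a', -, b', -, h1', h2', h3'⟩ := h'
  rw [add_one_le_iff] at *
  exact (div_unique (div_unique (h1.symm.trans h1') h2 h2').1 h3 h3').2

/-- This is how a code `w` is extended by a new leading digit. -/
theorem digit_top {w p q e : A.Num} (hw : w < p) (he : e < q) : Digit (w + e * p) p q e := by
  have h0 := zero_le w
  have h1 := mul_nonneg (zero_le e) (zero_le p)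
  exact ⟨0, by grind, w, by grind, by grind, (add_one_le_iff _ _).2 hw, (add_one_le_iff _ _).2 he⟩

/-- A summand divisible by `p * q` only changes the part of `w` above the digit with weight `p`; so
extending a code preserves its older digits. -/
theorem Digit.add_mul {w p q e : A.Num} (h : Digit w p q e) (hp : 0 < p) (hq : 0 < q)
    (c d : A.Num) : Digit (w + c * (p * q * d)) p q e := by
  obtain ⟨a, ha, b, hb, h1, h2, h3⟩ := h
  have h4 := mul_nonneg (zero_le c) (mul_nonneg (mul_nonneg (zero_le p) (zero_le q)) (zero_le d))
  have h5 : c * d ≤ c * (p * q * d) := by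
    rw [show c * (p * q * d) = c * d * (p * q) by ring]
    exact le_mul_of_pos (mul_pos hp hq)
  exact ⟨a + c * d, add_le_add ha h5, b, by grind, by rw [h1]; ring, h2, h3⟩

end S12Model

/-! ### Function variables that occur -/

/-- All function variables in `t` have index `< k`. -/
def Tm.FnScoped (k : ℕ) : Tm → Prop
  | var _ => True
  | zero => True
  | one => True
  | add s t => s.FnScoped k ∧ t.FnScoped k
  | mul s t => s.FnScoped k ∧ t.FnScoped k
  | len t => t.FnScoped k
  | half t => t.FnScoped k
  | smash s t => s.FnScoped k ∧ t.FnScoped k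
  | msp s t => s.FnScoped k ∧ t.FnScoped k
  | ap j t => j < k ∧ t.FnScoped k

/-- All free function variables in `φ` have index `< k`. -/
def Fm.FnScoped : ℕ → Fm → Prop
  | _, bot => True
  | k, eq s t => s.FnScoped k ∧ t.FnScoped k
  | k, le s t => s.FnScoped k ∧ t.FnScoped k
  | k, imp φ ψ => φ.FnScoped k ∧ ψ.FnScoped k
  | k, all φ => φ.FnScoped k
  | k, allFn φ => φ.FnScoped (k + 1)

section

variable (k : ℕ) (s t : Tm) (φ ψ : Fm)

@[simp] theorem Tm.fnScoped_var (i : ℕ) : (Tm.var i).FnScoped k := trivial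
@[simp] theorem Tm.fnScoped_zero : (0 : Tm).FnScoped k := trivial
@[simp] theorem Tm.fnScoped_one : (1 : Tm).FnScoped k := trivial
@[simp] theorem Tm.fnScoped_add : (s + t).FnScoped k ↔ s.FnScoped k ∧ t.FnScoped k := Iff.rfl
@[simp] theorem Tm.fnScoped_mul : (s * t).FnScoped k ↔ s.FnScoped k ∧ t.FnScoped k := Iff.rfl
@[simp] theorem Tm.fnScoped_len : (len t).FnScoped k ↔ t.FnScoped k := Iff.rfl
@[simp] theorem Tm.fnScoped_half : (half t).FnScoped k ↔ t.FnScoped k := Iff.rfl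
@[simp] theorem Tm.fnScoped_smash :
    (smash s t).FnScoped k ↔ s.FnScoped k ∧ t.FnScoped k := Iff.rfl
@[simp] theorem Tm.fnScoped_msp : (msp s t).FnScoped k ↔ s.FnScoped k ∧ t.FnScoped k := Iff.rfl
@[simp] theorem Tm.fnScoped_ap (j : ℕ) : (ap j t).FnScoped k ↔ j < k ∧ t.FnScoped k := Iff.rfl

variable {k s t φ ψ}

theorem Tm.FnScoped.subst {k' : ℕ} {ρ : ℕ → ℕ} {σ : ℕ → Tm} (h : t.FnScoped k)
    (hρ : ∀ j < k, ρ j < k') (hσ : ∀ i, (σ i).FnScoped k') : (t.subst ρ σ).FnScoped k' := by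
  induction t <;> simp_all [Tm.FnScoped, Tm.subst]

theorem Tm.FnScoped.shift (h : t.FnScoped k) : t.shift.FnScoped k :=
  h.subst (fun _ h => h) fun _ => trivial

theorem Tm.FnScoped.shiftFn (h : t.FnScoped k) : t.shiftFn.FnScoped (k + 1) :=
  h.subst (fun _ h => Nat.succ_lt_succ h) fun _ => trivial

theorem fnScoped_liftN {σ : ℕ → Tm} (hσ : ∀ i, (σ i).FnScoped k) (i : ℕ) :
    (liftN σ i).FnScoped k := by
  cases i with
  | zero => trivial
  | succ i => exact (hσ i).shift

theorem liftF_lt {k' : ℕ} {ρ : ℕ → ℕ} (hρ : ∀ j < k, ρ j < k') :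
    ∀ j < k + 1, liftF ρ j < k' + 1 := by
  rintro (_ | j) hj
  · exact Nat.succ_pos _
  · exact Nat.succ_lt_succ (hρ j (Nat.lt_of_succ_lt_succ hj))

theorem Fm.FnScoped.subst {k' : ℕ} {ρ : ℕ → ℕ} {σ : ℕ → Tm} (h : φ.FnScoped k)
    (hρ : ∀ j < k, ρ j < k') (hσ : ∀ i, (σ i).FnScoped k') : (φ.subst ρ σ).FnScoped k' := by
  induction φ generalizing k k' ρ σ with
  | bot => trivial
  | eq s t | le s t => exact ⟨h.1.subst hρ hσ, h.2.subst hρ hσ⟩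
  | imp φ ψ ih ih' => exact ⟨ih h.1 hρ hσ, ih' h.2 hρ hσ⟩
  | all φ ih => exact ih (k := k) h hρ (fnScoped_liftN hσ)
  | allFn φ ih => exact ih (k := k + 1) h (liftF_lt hρ) fun i => (hσ i).shiftFn

theorem Fm.FnScoped.and (h : φ.FnScoped k) (h' : ψ.FnScoped k) : (φ.and ψ).FnScoped k :=
  ⟨⟨h, h', trivial⟩, trivial⟩

theorem Fm.FnScoped.neg (h : φ.FnScoped k) : φ.neg.FnScoped k := ⟨h, trivial⟩

theorem Fm.FnScoped.ball (ht : t.FnScoped k) (h : φ.FnScoped k) : (Fm.ball t φ).FnScoped k :=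
  ⟨⟨trivial, ht.shift⟩, h⟩

theorem Fm.FnScoped.bex (ht : t.FnScoped k) (h : φ.FnScoped k) : (Fm.bex t φ).FnScoped k :=
  .neg (.ball ht (.neg h))

theorem Fm.FnScoped.bexs {ts : List Tm} (hts : ∀ t ∈ ts, t.FnScoped k) (h : φ.FnScoped k) :
    (Fm.bexs ts φ).FnScoped k := by
  induction ts with
  | nil => exact h
  | cons t ts ih =>
    exact .bex (hts t List.mem_cons_self) (ih fun s hs => hts s (List.mem_cons_of_mem _ hs))

theorem Tm.FnScoped.scoped_subst {k' n : ℕ} {ρ : ℕ → ℕ} {σ : ℕ → Tm} (h : t.FnScoped k)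
    (hρ : ∀ j < k, ρ j < k') (hσ : ∀ i, (σ i).Scoped k' n) : (t.subst ρ σ).Scoped k' n := by
  induction t <;> simp_all [Tm.FnScoped, Tm.subst, Tm.Scoped]

theorem Tm.Scoped.shift {n : ℕ} (h : t.Scoped k n) : t.shift.Scoped k (n + 1) := by
  induction t <;> simp_all [Tm.shift, Tm.subst, Tm.Scoped]

theorem Tm.Scoped.shiftFn {n : ℕ} (h : t.Scoped k n) : t.shiftFn.Scoped (k + 1) n := by
  induction t <;> simp_all [Tm.shiftFn, Tm.subst, Tm.Scoped]

theorem scoped_liftN {n : ℕ} {σ : ℕ → Tm} (hσ : ∀ i, (σ i).Scoped k n) (i : ℕ) :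
    (liftN σ i).Scoped k (n + 1) := by
  cases i with
  | zero => exact Nat.succ_pos n
  | succ i => exact (hσ i).shift

/-- Number variables are not tracked by `FnScoped`; they are confined only at the end, by a
substitution that sends the superfluous ones to 0. -/
theorem Fm.FnScoped.scoped_subst {k' n : ℕ} {ρ : ℕ → ℕ} {σ : ℕ → Tm} (h : φ.FnScoped k)
    (hρ : ∀ j < k, ρ j < k') (hσ : ∀ i, (σ i).Scoped k' n) : (φ.subst ρ σ).Scoped k' n := by
  induction φ generalizing k k' n ρ σ with
  | bot => trivial
  | eq s t | le s t => exact ⟨h.1.scoped_subst hρ hσ, h.2.scoped_subst hρ hσ⟩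
  | imp φ ψ ih ih' => exact ⟨ih h.1 hρ hσ, ih' h.2 hρ hσ⟩
  | all φ ih => exact ih (k := k) h hρ (scoped_liftN hσ)
  | allFn φ ih => exact ih (k := k + 1) h (liftF_lt hρ) fun i => (hσ i).shiftFn

end

/-! ### Blocks of bounded quantifiers -/

/-- The substitution for number variables under `n` number quantifiers. -/
def liftsN : ℕ → (ℕ → Tm) → ℕ → Tm
  | 0, σ => σ
  | n + 1, σ => liftsN n (liftN σ)

/-- Substitution in the bounds of a block of bounded quantifiers. -/
def substs (ρ : ℕ → ℕ) : (ℕ → Tm) → List Tm → List Tm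
  | _, [] => []
  | σ, t :: ts => t.subst ρ σ :: substs ρ (liftN σ) ts

@[simp] theorem length_substs (ρ : ℕ → ℕ) (σ : ℕ → Tm) (ts : List Tm) :
    (substs ρ σ ts).length = ts.length := by
  induction ts generalizing σ with
  | nil => rfl
  | cons t ts ih => simp [substs, ih]

theorem fnScoped_liftsN {k : ℕ} {σ : ℕ → Tm} (hσ : ∀ i, (σ i).FnScoped k) (n i : ℕ) :
    (liftsN n σ i).FnScoped k := by
  induction n generalizing σ with
  | zero => exact hσ i
  | succ n ih => exact ih (fnScoped_liftN hσ)

theorem scoped_liftsN {k m : ℕ} {σ : ℕ → Tm} (hσ : ∀ i, (σ i).Scoped k m) (n i : ℕ) :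
    (liftsN n σ i).Scoped k (m + n) := by
  induction n generalizing σ m with
  | zero => exact hσ i
  | succ n ih =>
    have := ih (scoped_liftN hσ)
    rwa [add_assoc, add_comm 1] at this

theorem fnScoped_substs {k k' : ℕ} {ρ : ℕ → ℕ} {σ : ℕ → Tm} {ts : List Tm}
    (h : ∀ t ∈ ts, t.FnScoped k) (hρ : ∀ j < k, ρ j < k') (hσ : ∀ i, (σ i).FnScoped k') :
    ∀ t ∈ substs ρ σ ts, t.FnScoped k' := by
  induction ts generalizing σ with
  | nil => simp [substs]
  | cons t ts ih =>
    simp only [substs, List.forall_mem_cons] at h ⊢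
    exact ⟨h.1.subst hρ hσ, ih h.2 (fnScoped_liftN hσ)⟩

theorem scoped_bexs_substs {k k' n : ℕ} {ρ : ℕ → ℕ} {σ : ℕ → Tm} {ts : List Tm} {φ : Fm}
    (h : ∀ t ∈ ts, t.FnScoped k) (hρ : ∀ j < k, ρ j < k') (hσ : ∀ i, (σ i).Scoped k' n)
    (hφ : φ.Scoped k' (n + ts.length)) : (Fm.bexs (substs ρ σ ts) φ).Scoped k' n := by
  induction ts generalizing σ n with
  | nil => exact hφ
  | cons t ts ih =>
    simp only [List.forall_mem_cons] at h
    refine ⟨⟨⟨Nat.succ_pos n, (h.1.scoped_subst hρ hσ).shift⟩,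
      ih h.2 (scoped_liftN hσ) ?_, trivial⟩, trivial⟩
    rwa [List.length_cons, add_comm ts.length, ← add_assoc] at hφ

theorem IsB1.bexs (ts : List Tm) {φ : Fm} (h : IsB1 true φ) : IsB1 true (Fm.bexs ts φ) := by
  induction ts with
  | nil => exact h
  | cons t ts ih => exact .bex t ih

section

variable {A : Model} {f : ℕ → A.Fn}

/-- There are values for a block of variables with bounds `ts` such that `P` holds under the
extended assignment. -/
def BoundedEx (A : Model) (f : ℕ → A.Fn) :
    List Tm → ((ℕ → A.Num) → Prop) → (ℕ → A.Num) → Prop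
  | [], P, v => P v
  | t :: ts, P, v => ∃ z ≤ t.val A f v, BoundedEx A f ts P (cons z v)

theorem Fm.sat_bexs (ts : List Tm) (φ : Fm) (v : ℕ → A.Num) :
    (Fm.bexs ts φ).Sat A f v ↔ BoundedEx A f ts (fun v' => φ.Sat A f v') v := by
  induction ts generalizing v with
  | nil => rfl
  | cons t ts ih => simp only [Fm.bexs, Fm.sat_bex, ih, BoundedEx]

theorem BoundedEx.mono {ts : List Tm} {P Q : (ℕ → A.Num) → Prop} {v : ℕ → A.Num}
    (h : BoundedEx A f ts P v)
    (hPQ : ∀ v', (∀ i, v' (i + ts.length) = v i) → P v' → Q v') : BoundedEx A f ts Q v := by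
  induction ts generalizing v with
  | nil => exact hPQ v (fun _ => rfl) h
  | cons t ts ih =>
    obtain ⟨z, hz, h⟩ := h
    refine ⟨z, hz, ih h fun v' hv' => hPQ v' fun i => ?_⟩
    have := hv' (i + 1)
    rwa [add_assoc, add_comm 1] at this

theorem BoundedEx.exists {ts : List Tm} {P : (ℕ → A.Num) → Prop} {v : ℕ → A.Num}
    (h : BoundedEx A f ts P v) : ∃ v', (∀ i, v' (i + ts.length) = v i) ∧ P v' := by
  induction ts generalizing v with
  | nil => exact ⟨v, fun _ => rfl, h⟩
  | cons t ts ih =>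
    obtain ⟨z, hz, h⟩ := h
    obtain ⟨v', hv', h⟩ := ih h
    refine ⟨v', fun i => ?_, h⟩
    have := hv' (i + 1)
    rwa [add_assoc, add_comm 1] at this

theorem boundedEx_append (ts us : List Tm) (P : (ℕ → A.Num) → Prop) (v : ℕ → A.Num) :
    BoundedEx A f (ts ++ us) P v ↔ BoundedEx A f ts (BoundedEx A f us P) v := by
  induction ts generalizing v with
  | nil => rfl
  | cons t ts ih => simp only [List.cons_append, BoundedEx, ih]

theorem val_liftN (σ : ℕ → Tm) (a : A.Num) (v : ℕ → A.Num) :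
    (fun i => (liftN σ i).val A f (cons a v)) = cons a fun i => (σ i).val A f v := by
  funext i
  cases i with
  | zero => rfl
  | succ i => exact Tm.val_shift A f a v (σ i)

/-- The substitution lemma for prefixes. Below the prefix only the value of the term `t` matters to
`P`, which is the form in which bounds for values occur. -/
theorem boundedEx_substs (ρ : ℕ → ℕ) (σ : ℕ → Tm) (ts : List Tm) (t : Tm) (P : A.Num → Prop)
    (v : ℕ → A.Num) :
    BoundedEx A f (substs ρ σ ts)
        (fun v' => P ((t.subst ρ (liftsN ts.length σ)).val A f v')) v ↔
      BoundedEx A (fun j => f (ρ j)) ts (fun v' => P (t.val A (fun j => f (ρ j)) v'))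
        fun i => (σ i).val A f v := by
  induction ts generalizing σ v with
  | nil => simp only [substs, BoundedEx, List.length_nil, liftsN, Tm.val_subst]
  | cons s ts ih =>
    simp only [substs, BoundedEx, List.length_cons, liftsN, ih]
    simp only [Tm.val_subst, val_liftN]

end

/-! ### Definable functions -/

/-- `Σ^b_1` definitions of total functions in `S^1_2`, with bounds for their values. The arguments
of the function are the values of all variables. -/
structure Dfn (k : ℕ) where
  /-- the defining formula, in which the variable `0` stands for the value of the function -/
  graph : Fm
  bounds : List Tm
  bound : Tm
  isB1 : IsB1 true graph
  graph_fnScoped : graph.FnScoped k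
  bounds_fnScoped : ∀ t ∈ bounds, t.FnScoped k
  bound_fnScoped : bound.FnScoped k
  total : ∀ (A : S12Model) (f : ℕ → A.Fn) (v : ℕ → A.Num), ∃ y,
    graph.Sat A.toModel f (cons y v) ∧
      BoundedEx A.toModel f bounds (fun v' => y ≤ bound.val A.toModel f v') v
  unique : ∀ (A : S12Model) (f : ℕ → A.Fn) (v : ℕ → A.Num) (y y' : A.Num),
    graph.Sat A.toModel f (cons y v) → graph.Sat A.toModel f (cons y' v) → y = y'

namespace Dfn

variable {k : ℕ} (D : Dfn k)

section

variable (A : S12Model) (f : ℕ → A.Fn) (v : ℕ → A.Num)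

/-- The function defined by `D` in a model. -/
noncomputable def val : A.Num := (D.total A f v).choose

theorem sat_graph_val : D.graph.Sat A.toModel f (cons (D.val A f v) v) :=
  (D.total A f v).choose_spec.1

theorem boundedEx_val :
    BoundedEx A.toModel f D.bounds (fun v' => D.val A f v ≤ D.bound.val A.toModel f v') v :=
  (D.total A f v).choose_spec.2

variable {A f v}

theorem sat_graph_iff {y : A.Num} : D.graph.Sat A.toModel f (cons y v) ↔ y = D.val A f v :=
  ⟨fun h => D.unique A f v _ _ h (D.sat_graph_val A f v), fun h => h ▸ D.sat_graph_val A f v⟩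

end

/-- The `Σ^b_1` formula that says `φ(y)` for the value `y` of the defined function at the
arguments `σ`. -/
def bind (σ : ℕ → Tm) (φ : Fm) : Fm :=
  Fm.bexs (substs id σ D.bounds) (Fm.bex (D.bound.subst id (liftsN D.bounds.length σ))
    (.and (D.graph.subst id (cons (Tm.var 0) fun i =>
        (σ i).subst id fun j => Tm.var (j + D.bounds.length + 1)))
      (φ.subst id (cons (Tm.var 0) fun i => Tm.var (i + D.bounds.length + 1)))))

theorem bind_isB1 (σ : ℕ → Tm) {φ : Fm} (h : IsB1 true φ) : IsB1 true (D.bind σ φ) :=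
  .bexs _ (.bex _ (.and (D.isB1.subst _ _) (h.subst _ _)))

theorem bind_fnScoped {σ : ℕ → Tm} {φ : Fm} (hσ : ∀ i, (σ i).FnScoped k) (h : φ.FnScoped k) :
    (D.bind σ φ).FnScoped k := by
  refine .bexs (fnScoped_substs D.bounds_fnScoped (fun _ h => h) hσ)
    (.bex (D.bound_fnScoped.subst (fun _ h => h) (fnScoped_liftsN hσ _))
      (.and (D.graph_fnScoped.subst (fun _ h => h) ?_) (h.subst (fun _ h => h) ?_)))
  · rintro (_ | i)
    · trivial
    · exact (hσ i).subst (fun _ h => h) fun _ => trivial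
  · rintro (_ | i) <;> trivial

-- Totality provides witnesses for the prefix. Conversely, the graph does not depend on the prefix
-- and determines the value uniquely, so any witnesses lead to the same `y`.
@[simp] theorem sat_bind {A : S12Model} {f : ℕ → A.Fn} {v : ℕ → A.Num} (σ : ℕ → Tm) (φ : Fm) :
    (D.bind σ φ).Sat A.toModel f v ↔
      φ.Sat A.toModel f (cons (D.val A f fun i => (σ i).val A.toModel f v) v) := by
  have key : ∀ (v' : ℕ → A.Num) (y : A.Num), (∀ i, v' (i + D.bounds.length) = v i) →
      ((Fm.and (D.graph.subst id (cons (Tm.var 0) fun i =>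
          (σ i).subst id fun j => Tm.var (j + D.bounds.length + 1)))
        (φ.subst id (cons (Tm.var 0) fun i => Tm.var (i + D.bounds.length + 1)))).Sat
          A.toModel f (cons y v') ↔ y = D.val A f (fun i => (σ i).val A.toModel f v) ∧
        φ.Sat A.toModel f (cons y v)) := by
    intro v' y hv'
    simp only [Fm.sat_and, Fm.sat_subst, comp_cons, Tm.val_var, cons_zero, Tm.val_subst,
      cons_succ, hv', id]
    rw [← D.sat_graph_iff]
  rw [bind, Fm.sat_bexs]
  constructor
  · intro h
    obtain ⟨v', hv', h⟩ := h.exists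
    rw [length_substs] at hv'
    rw [Fm.sat_bex] at h
    obtain ⟨y, -, h⟩ := h
    obtain ⟨rfl, h⟩ := (key v' y hv').1 h
    exact h
  · intro h
    have h1 := (boundedEx_substs id σ D.bounds D.bound _ v).2
      (D.boundedEx_val A f fun i => (σ i).val A.toModel f v)
    refine h1.mono fun v' hv' h2 => ?_
    rw [length_substs] at hv'
    rw [Fm.sat_bex]
    exact ⟨_, h2, (key v' _ hv').2 ⟨rfl, h⟩⟩

/-- The function given by a term. -/
def ofTm (t : Tm) (ht : t.FnScoped k) : Dfn k where
  graph := .eq (.var 0) t.shift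
  bounds := []
  bound := t
  isB1 := .eq _ _ _
  graph_fnScoped := ⟨trivial, ht.shift⟩
  bounds_fnScoped := by simp
  bound_fnScoped := ht
  total A f v := ⟨t.val A.toModel f v, by simp [Tm.val_shift], le_rfl⟩
  unique A f v y y' h h' := by
    simp only [Fm.sat_eq, Tm.val_var, cons_zero, Tm.val_shift] at h h'
    rw [h, h']

@[simp] theorem val_ofTm (t : Tm) (ht : t.FnScoped k) (A : S12Model) (f : ℕ → A.Fn)
    (v : ℕ → A.Num) : (ofTm t ht).val A f v = t.val A.toModel f v := by
  have h := (ofTm t ht).sat_graph_val A f v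
  simpa only [ofTm, Fm.sat_eq, Tm.val_var, cons_zero, Tm.val_shift] using h

/-- Substitution of terms for the arguments. -/
def subst {k' : ℕ} (ρ : ℕ → ℕ) (σ : ℕ → Tm) (hρ : ∀ j < k, ρ j < k')
    (hσ : ∀ i, (σ i).FnScoped k') : Dfn k' where
  graph := D.graph.subst ρ (liftN σ)
  bounds := substs ρ σ D.bounds
  bound := D.bound.subst ρ (liftsN D.bounds.length σ)
  isB1 := D.isB1.subst _ _
  graph_fnScoped := D.graph_fnScoped.subst hρ (fnScoped_liftN hσ)
  bounds_fnScoped := fnScoped_substs D.bounds_fnScoped hρ hσ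
  bound_fnScoped := D.bound_fnScoped.subst hρ (fnScoped_liftsN hσ _)
  total A f v := by
    simp only [Fm.sat_subst, val_liftN]
    exact ⟨_, D.sat_graph_val A _ _,
      (boundedEx_substs ρ σ D.bounds D.bound _ v).2 (D.boundedEx_val A _ _)⟩
  unique A f v y y' h h' := by
    simp only [Fm.sat_subst, val_liftN] at h h'
    exact D.unique A _ _ _ _ h h'

@[simp] theorem val_subst {k' : ℕ} (ρ : ℕ → ℕ) (σ : ℕ → Tm) (hρ : ∀ j < k, ρ j < k')
    (hσ : ∀ i, (σ i).FnScoped k') (A : S12Model) (f : ℕ → A.Fn) (v : ℕ → A.Num) :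
    (D.subst ρ σ hρ hσ).val A f v =
      D.val A (fun j => f (ρ j)) fun i => (σ i).val A.toModel f v := by
  have h := (D.subst ρ σ hρ hσ).sat_graph_val A f v
  simp only [subst, Fm.sat_subst, val_liftN, D.sat_graph_iff] at h
  exact h

/-- The composition `D(E(x⃗), x⃗)`. -/
def comp (E : Dfn k) : Dfn k where
  graph := E.bind (fun i => .var (i + 1))
    (D.graph.subst id (cons (.var 1) (cons (.var 0) fun i => .var (i + 2))))
  -- The value of `E` is itself quantified in the prefix; the bounds of `D` refer to it as their
  -- first argument.
  bounds := E.bounds ++ E.bound :: substs id (cons (.var 0) fun i => .var (i + E.bounds.length + 1))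
    D.bounds
  bound := D.bound.subst id (liftsN D.bounds.length
    (cons (.var 0) fun i => .var (i + E.bounds.length + 1)))
  isB1 := E.bind_isB1 _ (D.isB1.subst _ _)
  graph_fnScoped := E.bind_fnScoped (fun _ => trivial) (D.graph_fnScoped.subst (fun _ h => h) (by
    rintro (_ | _ | i) <;> trivial))
  bounds_fnScoped := by
    simp only [List.forall_mem_append, List.forall_mem_cons]
    exact ⟨E.bounds_fnScoped, E.bound_fnScoped, fnScoped_substs D.bounds_fnScoped (fun _ h => h) (by
      rintro (_ | i) <;> trivial)⟩
  bound_fnScoped := D.bound_fnScoped.subst (fun _ h => h) (fnScoped_liftsN (by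
      rintro (_ | i) <;> trivial) _)
  total A f v := by
    refine ⟨D.val A f (cons (E.val A f v) v), ?_, ?_⟩
    · simp [Fm.sat_subst, comp_cons, D.sat_graph_iff]
    · rw [boundedEx_append]
      refine (E.boundedEx_val A f v).mono fun v' hv' h => ⟨_, h, ?_⟩
      refine (boundedEx_substs id _ D.bounds D.bound _ _).2 ?_
      simp only [comp_cons, Tm.val_var, cons_zero, cons_succ, hv', id]
      exact D.boundedEx_val A f _
  unique A f v y y' h h' := by
    simp only [sat_bind, Fm.sat_subst, comp_cons, Tm.val_var, cons_zero, cons_succ, id,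
      D.sat_graph_iff] at h h'
    rw [h, h']

@[simp] theorem val_comp (E : Dfn k) (A : S12Model) (f : ℕ → A.Fn) (v : ℕ → A.Num) :
    (D.comp E).val A f v = D.val A f (cons (E.val A f v) v) := by
  have h := (D.comp E).sat_graph_val A f v
  simpa only [comp, sat_bind, Fm.sat_subst, comp_cons, Tm.val_var, cons_zero, cons_succ, cons_one,
      id, D.sat_graph_iff] using h

end Dfn

/-! ### Distinction of cases and extraction of digits -/

namespace Dfn

variable {k : ℕ}

/-- Distinction of cases: the second, third or fourth argument according to whether the first
argument is zero, even or odd. -/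
def cases : Dfn k where
  graph := .or (.and (.eq (.var 1) 0) (.eq (.var 0) (.var 2)))
    (.and (.neg (.eq (.var 1) 0))
      (.or (.and (.eq (.half (.var 1) + .half (.var 1)) (.var 1)) (.eq (.var 0) (.var 3)))
        (.and (.neg (.eq (.half (.var 1) + .half (.var 1)) (.var 1))) (.eq (.var 0) (.var 4)))))
  bounds := []
  bound := .var 1 + .var 2 + .var 3
  isB1 := .or (.and (.eq _ _ _) (.eq _ _ _)) (.and (.neg (.eq _ _ _)) (.or
    (.and (.eq _ _ _) (.eq _ _ _)) (.and (.neg (.eq _ _ _)) (.eq _ _ _))))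
  graph_fnScoped := by simp [Fm.FnScoped, Fm.or, Fm.and, Fm.neg]
  bounds_fnScoped := by simp
  bound_fnScoped := by simp
  total A f v := by
    have h1 := S12Model.zero_le (v 1)
    have h2 := S12Model.zero_le (v 2)
    have h3 := S12Model.zero_le (v 3)
    simp only [Fm.sat_or, Fm.sat_and, Fm.sat_eq, Fm.sat_neg, Tm.val_var, Tm.val_zero, Tm.val_add,
      Tm.val_half, cons_zero, cons_one, cons_two, cons_three, cons_four, BoundedEx]
    by_cases h : v 0 = 0
    · exact ⟨v 1, by simp [h], by grind⟩
    · by_cases h' : A.half (v 0) + A.half (v 0) = v 0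
      · exact ⟨v 2, by simp [h, h'], by grind⟩
      · exact ⟨v 3, by simp [h, h'], by grind⟩
  unique A f v y y' := by
    simp only [Fm.sat_or, Fm.sat_and, Fm.sat_eq, Fm.sat_neg, Tm.val_var, Tm.val_zero, Tm.val_add,
      Tm.val_half, cons_zero, cons_one, cons_two, cons_three, cons_four]
    grind

theorem val_cases (A : S12Model) (f : ℕ → A.Fn) (v : ℕ → A.Num) :
    (v 0 = 0 → (cases (k := k)).val A f v = v 1) ∧
    (v 0 ≠ 0 → A.half (v 0) + A.half (v 0) = v 0 → (cases (k := k)).val A f v = v 2) ∧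
    (v 0 ≠ 0 → A.half (v 0) + A.half (v 0) ≠ v 0 → (cases (k := k)).val A f v = v 3) := by
  have h := (cases (k := k)).sat_graph_val A f v
  generalize cases.val A f v = y at h ⊢
  simp only [cases, Fm.sat_or, Fm.sat_and, Fm.sat_eq, Fm.sat_neg, Tm.val_var, Tm.val_zero,
    Tm.val_add, Tm.val_half, cons_zero, cons_one, cons_two, cons_three, cons_four] at h
  grind

/-- The digit of `w` in base `1 # k` at the position with weight `s # k`, for the arguments
`w, s, k`. -/
def digit : Dfn k where
  graph := .bex (.var 1) (.bex (.var 2) (.and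
    (.eq (.var 3) ((.var 1 * .smash 1 (.var 5) + .var 2) * .smash (.var 4) (.var 5) + .var 0))
    (.and (.le (.var 0 + 1) (.smash (.var 4) (.var 5))) (.le (.var 2 + 1) (.smash 1 (.var 5))))))
  bounds := []
  bound := .var 0
  isB1 := .bex _ (.bex _ (.and (.eq _ _ _) (.and (.le _ _ _) (.le _ _ _))))
  graph_fnScoped := .bex trivial (.bex trivial (by simp [Fm.FnScoped, Fm.and, Fm.neg]))
  bounds_fnScoped := by simp
  bound_fnScoped := by simp
  total A f v := by
    obtain ⟨e, he, h⟩ := S12Model.exists_digit (v 0) (S12Model.smash_pos (v 1) (v 2))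
      (S12Model.smash_pos 1 (v 2))
    exact ⟨e, by simpa [S12Model.Digit] using h, he⟩
  unique A f v y y' h h' := by
    refine S12Model.Digit.unique (w := v 0) (p := A.smash (v 1) (v 2)) (q := A.smash 1 (v 2)) ?_ ?_
    · simpa [S12Model.Digit] using h
    · simpa [S12Model.Digit] using h'

theorem digit_val (A : S12Model) (f : ℕ → A.Fn) (v : ℕ → A.Num) :
    S12Model.Digit (v 0) (A.smash (v 1) (v 2)) (A.smash 1 (v 2)) ((digit (k := k)).val A f v) := by
  have h := (digit (k := k)).sat_graph_val A f v
  simpa [digit, S12Model.Digit] using h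

end Dfn

namespace S12Model

variable {A : S12Model}

/-- The digit of `w` in base `1 # k` at the position with weight `s # k`. -/
noncomputable def dig (w s k : A.Num) : A.Num :=
  (Dfn.digit (k := 0)).val A (fun _ => A.fn) (cons w (cons s (cons k fun _ => 0)))

theorem digit_dig (w s k : A.Num) : Digit w (A.smash s k) (A.smash 1 k) (dig w s k) :=
  Dfn.digit_val A (fun _ => A.fn) (cons w (cons s (cons k fun _ => 0)))

theorem Digit.dig_eq {w s k e : A.Num} (h : Digit w (A.smash s k) (A.smash 1 k) e) :
    dig w s k = e := (digit_dig w s k).unique h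

theorem dig_lt (w s k : A.Num) : dig w s k < A.smash 1 k := by
  obtain ⟨a, -, b, -, -, -, h⟩ := digit_dig w s k
  exact (add_one_le_iff _ _).1 h

end S12Model

namespace Dfn

open S12Model

variable {k : ℕ}

theorem val_digit (A : S12Model) (f : ℕ → A.Fn) (v : ℕ → A.Num) :
    (digit (k := k)).val A f v = dig (v 0) (v 1) (v 2) :=
  (digit_val A f v).dig_eq.symm

/-! ### Maximum over the prefixes of a number -/

section

variable (D : Dfn k)

/-- Induction on `i`, for the prefixes of length at most `i`. The property is Σ^b_1 because the
quantifier over `j` is sharply bounded and the values of `D` enter through `bind`. -/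
theorem exists_max (A : S12Model) (f : ℕ → A.Fn) (y : A.Num) (v : ℕ → A.Num) :
    ∃ i ≤ A.len y, ∀ j ≤ A.len y,
      D.val A f (cons (A.msp y j) v) ≤ D.val A f (cons (A.msp y i) v) := by
  have := A.lind
    (φ := .bex (.len (.var 1)) (D.bind (cons (.msp (.var 2) (.var 0)) fun i => .var (i + 3))
      (.ball (.len (.var 3)) (.imp (.le (.var 0) (.var 3))
        (D.bind (cons (.msp (.var 4) (.var 0)) fun i => .var (i + 5)) (.le (.var 0) (.var 2)))))))
    (.bex _ (D.bind_isB1 _ (.sball _ (.imp (.le _ _ _) (D.bind_isB1 _ (.le _ _ _)))))) f (cons y v)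
    (P := fun i => ∃ m ≤ A.len y, ∀ j ≤ A.len y, j ≤ i →
      D.val A f (cons (A.msp y j) v) ≤ D.val A f (cons (A.msp y m) v))
    (fun a => by simp [comp_cons]) ⟨0, zero_le _, fun j _ hj => by rw [le_antisymm hj (zero_le j)]⟩
    ?_ (le_refl (A.len y))
  · obtain ⟨i, hi, h⟩ := this
    exact ⟨i, hi, fun j hj => h j hj hj⟩
  · rintro i ⟨m, hm, h⟩
    have hle : ∀ j, j ≤ i + 1 → j ≤ i ∨ j = i + 1 := fun j hj => by
      rcases hj.lt_or_eq with h | h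
      · rw [← add_one_le_iff] at h
        exact Or.inl (le_of_add_le_add_right h)
      · exact Or.inr h
    by_cases hi : i + 1 ≤ A.len y ∧
        D.val A f (cons (A.msp y m) v) ≤ D.val A f (cons (A.msp y (i + 1)) v)
    · refine ⟨i + 1, hi.1, fun j hj hji => ?_⟩
      rcases hle j hji with h1 | rfl
      · exact (h j hj h1).trans hi.2
      · exact le_rfl
    · refine ⟨m, hm, fun j hj hji => ?_⟩
      rcases hle j hji with h1 | rfl
      · exact h j hj h1
      · exact (le_total _ _).resolve_left fun h2 => hi ⟨hj, h2⟩

/-- The maximum of the values of `D` at the prefixes of the first argument. -/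
def max : Dfn k where
  graph := .and (.bex (.len (.var 1)) (D.bind (cons (.msp (.var 2) (.var 0)) fun i => .var (i + 3))
      (.eq (.var 2) (.var 0))))
    (.ball (.len (.var 1)) (D.bind (cons (.msp (.var 2) (.var 0)) fun i => .var (i + 3))
      (.le (.var 0) (.var 2))))
  -- The first quantified variable is the length of a prefix where the maximum is attained; the
  -- bounds of `D` at that prefix then apply.
  bounds := .len (.var 0) :: substs id (cons (.msp (.var 1) (.var 0)) fun i => .var (i + 2)) D.bounds
  bound := D.bound.subst id (liftsN D.bounds.length
    (cons (.msp (.var 1) (.var 0)) fun i => .var (i + 2)))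
  isB1 := .and (.bex _ (D.bind_isB1 _ (.eq _ _ _))) (.sball _ (D.bind_isB1 _ (.le _ _ _)))
  graph_fnScoped := by
    have h : ∀ i, (cons (.msp (.var 2) (.var 0)) (fun i => .var (i + 3)) i : Tm).FnScoped k := by
      rintro (_ | i) <;> simp
    exact .and (.bex trivial (D.bind_fnScoped h ⟨trivial, trivial⟩))
      (.ball trivial (D.bind_fnScoped h ⟨trivial, trivial⟩))
  bounds_fnScoped := by
    simp only [List.forall_mem_cons]
    exact ⟨trivial, fnScoped_substs D.bounds_fnScoped (fun _ h => h) (by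
      rintro (_ | i) <;> simp)⟩
  bound_fnScoped := D.bound_fnScoped.subst (fun _ h => h) (fnScoped_liftsN (by
      rintro (_ | i) <;> simp) _)
  total A f v := by
    obtain ⟨i, hi, h⟩ := D.exists_max A f (v 0) fun i => v (i + 1)
    refine ⟨D.val A f (cons (A.msp (v 0) i) fun i => v (i + 1)), ?_, i, hi, ?_⟩
    · simp only [Fm.sat_and, Fm.sat_bex, Fm.sat_ball, sat_bind, Fm.sat_eq, Fm.sat_le, comp_cons,
        Tm.val_var, Tm.val_msp, Tm.val_len, cons_zero, cons_succ]
      exact ⟨⟨i, hi, rfl⟩, h⟩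
    · refine (boundedEx_substs id _ D.bounds D.bound _ _).2 ?_
      simp only [comp_cons, Tm.val_var, Tm.val_msp, cons_zero, cons_succ]
      exact D.boundedEx_val A f _
  unique A f v y y' := by
    simp only [Fm.sat_and, Fm.sat_bex, Fm.sat_ball, sat_bind, Fm.sat_eq, Fm.sat_le, comp_cons,
        Tm.val_var, Tm.val_msp, Tm.val_len, cons_zero, cons_succ]
    rintro ⟨⟨i, hi, rfl⟩, h⟩ ⟨⟨i', hi', rfl⟩, h'⟩
    exact le_antisymm (h' i hi) (h i' hi')

theorem val_le_val_max (A : S12Model) (f : ℕ → A.Fn) (y : A.Num) (v : ℕ → A.Num) {i : A.Num}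
    (hi : i ≤ A.len y) : D.val A f (cons (A.msp y i) v) ≤ D.max.val A f (cons y v) := by
  have h := D.max.sat_graph_val A f (cons y v)
  simp only [max, Fm.sat_and, Fm.sat_bex, Fm.sat_ball, sat_bind, Fm.sat_eq, Fm.sat_le, comp_cons,
        Tm.val_var, Tm.val_msp, Tm.val_len, cons_zero, cons_succ] at h
  exact h.2 i hi

end

end Dfn
-- Recursion on notation along the prefixes of a number
namespace S12Model

variable {A : S12Model}

/-- Halving removes the last bit of a prefix, which turns recursion on ⌊y/2⌋ into induction on
lengths. The empty prefix is its own half and needs separate treatment. -/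
theorem half_msp {y j : A.Num} (hj : j ≤ A.len y) :
    (j = 0 ∧ A.half (A.msp y j) = A.msp y j) ∨ ∃ i, j = i + 1 ∧ A.half (A.msp y j) = A.msp y i := by
  by_cases h0 : j = 0
  · subst h0
    exact Or.inl ⟨rfl, by rw [msp_zero, half_zero]⟩
  · obtain ⟨i, rfl⟩ := exists_add_of_le ((one_le_iff j).2 (lt_of_le_of_ne (zero_le j) (Ne.symm h0)))
    rw [add_comm] at hj ⊢
    exact Or.inr ⟨i, rfl, (msp_eq_half ((add_one_le_iff _ _).1 hj)).symm⟩

end S12Model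

namespace Dfn

open S12Model

variable {k : ℕ} (S : Dfn k)

/-- The recursion equation at the prefix of length `var 0` of `y` for the sequence of digits of
`var 1`. The variables from 3 on stand for the bound, `y`, and the parameters. -/
def recStep : Fm :=
  (digit (k := k)).bind (cons (.var 1) (cons (.msp (.var 4) (.var 0)) (cons (.var 3) .var)))
    ((digit (k := k)).bind (cons (.var 2) (cons (.half (.msp (.var 5) (.var 1))) (cons (.var 4) .var)))
      (S.bind (cons (.msp (.var 6) (.var 2)) (cons (.var 0) fun i => .var (i + 7)))
        (.eq (.var 2) (.msp (.var 0) (.len (.var 6))))))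

/-- The digits of `w` are the values of the recursion at the prefix of length `j` of `y` and its
half. -/
def RecStep (A : S12Model) (f : ℕ → A.Fn) (w b y : A.Num) (x : ℕ → A.Num) (j : A.Num) : Prop :=
  dig w (A.msp y j) b =
    A.msp (S.val A f (cons (A.msp y j) (cons (dig w (A.half (A.msp y j)) b) x))) (A.len b)

theorem sat_recStep (A : S12Model) (f : ℕ → A.Fn) (j w u b y : A.Num) (x : ℕ → A.Num) :
    S.recStep.Sat A.toModel f (cons j (cons w (cons u (cons b (cons y x))))) ↔
      S.RecStep A f w b y x j := by
  simp [recStep, RecStep, val_digit, comp_cons]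

theorem recStep_isB1 : IsB1 true S.recStep :=
  digit.bind_isB1 _ (digit.bind_isB1 _ (S.bind_isB1 _ (.eq _ _ _)))

theorem recStep_fnScoped : S.recStep.FnScoped k := by
  refine bind_fnScoped _ ?_ (bind_fnScoped _ ?_ (bind_fnScoped _ ?_ (by simp [Fm.FnScoped])))
  · rintro (_ | _ | _ | i) <;> simp
  · rintro (_ | _ | _ | i) <;> simp
  · rintro (_ | _ | i) <;> simp

variable {S}

theorem RecStep.congr {A : S12Model} {f : ℕ → A.Fn} {w w' b y : A.Num} {x : ℕ → A.Num} {j : A.Num}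
    (h : S.RecStep A f w b y x j) (h₁ : dig w' (A.msp y j) b = dig w (A.msp y j) b)
    (h₂ : dig w' (A.half (A.msp y j)) b = dig w (A.half (A.msp y j)) b) :
    S.RecStep A f w' b y x j := by
  rw [RecStep, h₁, h₂]
  exact h

/-- The code is built digit by digit. The prefix of length `i` has weight 2^(i|b|), so a code up to
this prefix lies below 2^((i+1)|b|), the weight of the next digit; this bound is carried along in
the induction. -/
theorem exists_recStep
    (hS : ∀ (A : S12Model) (f : ℕ → A.Fn) (e e' : A.Num) (x : ℕ → A.Num),
      S.val A f (cons 0 (cons e x)) = S.val A f (cons 0 (cons e' x)))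
    (A : S12Model) (f : ℕ → A.Fn) (b y : A.Num) (x : ℕ → A.Num) :
    ∃ w ≤ A.smash y b * A.smash 1 b, ∀ j ≤ A.len y, S.RecStep A f w b y x j := by
  have h01 := A.zero_lt_one'
  have hq : 0 < A.smash 1 b := smash_pos 1 b
  have := A.lind
    (φ := .imp (.le (.var 0) (.len (.var 2)))
      (.bex (.smash (.var 2) (.var 1) * .smash 1 (.var 1))
        (.and (.le (.var 0 + 1) (.smash (.msp (.var 3) (.var 1)) (.var 2) * .smash 1 (.var 2)))
          (.ball (.len (.var 3)) (.imp (.le (.var 0) (.var 2)) S.recStep)))))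
    (.imp (.le _ _ _) (.bex _ (.and (.le _ _ _) (.sball _ (.imp (.le _ _ _) S.recStep_isB1)))))
    f (cons b (cons y x))
    (P := fun i => i ≤ A.len y → ∃ w ≤ A.smash y b * A.smash 1 b,
      w + 1 ≤ A.smash (A.msp y i) b * A.smash 1 b ∧
        ∀ j ≤ A.len y, j ≤ i → S.RecStep A f w b y x j)
    (fun a => by simp [sat_recStep]) ?_ ?_ (le_refl (A.len y))
  · obtain ⟨w, hw, -, h⟩ := this le_rfl
    exact ⟨w, hw, fun j hj => h j hj hj⟩
  · intro _
    set e := A.msp (S.val A f (cons 0 (cons 0 x))) (A.len b) with he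
    have h1 : e < A.smash 1 b := lt_one_smash_of_len_le (len_msp_le _ _)
    have h2 : dig e 0 b = e := by
      have := digit_top (A := A) (w := 0) (p := A.smash 0 b) (smash_pos 0 b) h1
      rw [zero_smash, mul_one, zero_add] at this
      exact Digit.dig_eq (by rwa [zero_smash])
    refine ⟨e, ?_, ?_, fun j _ hj => ?_⟩
    · refine h1.le.trans ?_
      rw [mul_comm]
      exact le_mul_of_pos (smash_pos y b)
    · rwa [msp_zero, zero_smash, one_mul, add_one_le_iff]
    -- At the empty prefix the equation refers to the very digit it determines, as ⌊0/2⌋ = 0; `hS`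
    -- removes this circularity.
    · rw [le_antisymm hj (zero_le j), RecStep, msp_zero, half_zero, h2, hS A f e 0 x]
  · intro i ih hi
    have hi' : i ≤ A.len y := by grind
    obtain ⟨w, -, hw, h⟩ := ih hi'
    set e := A.msp (S.val A f (cons (A.msp y (i + 1)) (cons (dig w (A.msp y i) b) x))) (A.len b)
      with he
    have h1 : e < A.smash 1 b := lt_one_smash_of_len_le (len_msp_le _ _)
    have hp := msp_add_one hi b
    rw [← hp] at hw
    -- The weight of the new digit is a multiple of the weight at `j` times the base, so the digits
    -- at `j ≤ i` survive.
    have hlow : ∀ j ≤ i, dig (w + e * A.smash (A.msp y (i + 1)) b) (A.msp y j) b =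
        dig w (A.msp y j) b := by
      intro j hj
      have hlen : A.len (A.msp y j) ≤ A.len (A.msp y i) := by
        rwa [len_msp (hj.trans hi'), len_msp hi']
      obtain ⟨c, hc⟩ := exists_smash_eq_mul hlen b
      refine Digit.dig_eq ?_
      have := (digit_dig w (A.msp y j) b).add_mul (smash_pos _ _) hq e (A.smash c b)
      rwa [mul_right_comm, ← hc, ← hp] at this
    have htop : dig (w + e * A.smash (A.msp y (i + 1)) b) (A.msp y (i + 1)) b = e :=
      Digit.dig_eq (digit_top ((add_one_le_iff _ _).1 hw) h1)
    have hlt : w + e * A.smash (A.msp y (i + 1)) b + 1 ≤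
        A.smash (A.msp y (i + 1)) b * A.smash 1 b := by
      have h2 := mul_le_mul_of_nonneg_left ((add_one_le_iff _ _).2 h1)
        (zero_le (A.smash (A.msp y (i + 1)) b))
      rw [mul_add, mul_one, mul_comm _ e] at h2
      grind
    refine ⟨w + e * A.smash (A.msp y (i + 1)) b, ?_, hlt, fun j hj hji => ?_⟩
    · have h2 : A.smash (A.msp y (i + 1)) b ≤ A.smash y b :=
        smash_mono_left (by rwa [len_msp hi]) b
      have h3 := mul_le_mul_of_nonneg_right h2 hq.le
      grind
    · rcases hji.lt_or_eq with hji | rfl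
      · rw [← add_one_le_iff] at hji
        have hji : j ≤ i := le_of_add_le_add_right hji
        refine (h j hj hji).congr (hlow j hji) ?_
        rcases half_msp hj with ⟨-, h2⟩ | ⟨m, rfl, h2⟩
        · rw [h2, hlow j hji]
        · rw [h2, hlow m (by grind)]
      · rcases half_msp hj with ⟨h2, -⟩ | ⟨m, h2, h3⟩
        · have := zero_le i
          grind
        · obtain rfl : i = m := add_right_cancel h2
          rw [RecStep, htop, h3, hlow i le_rfl]

/-- The recursion equations determine all digits at prefixes of `y`, by induction on the length. The
codes themselves need not coincide; only the last digit is output. -/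
theorem dig_unique_of_recStep
    (hS : ∀ (A : S12Model) (f : ℕ → A.Fn) (e e' : A.Num) (x : ℕ → A.Num),
      S.val A f (cons 0 (cons e x)) = S.val A f (cons 0 (cons e' x)))
    {A : S12Model} {f : ℕ → A.Fn} {b y : A.Num} {x : ℕ → A.Num} {w w' : A.Num}
    (h : ∀ j ≤ A.len y, S.RecStep A f w b y x j) (h' : ∀ j ≤ A.len y, S.RecStep A f w' b y x j) :
    dig w y b = dig w' y b := by
  have := A.lind
    (φ := .imp (.le (.var 0) (.len (.var 4)))
      ((digit (k := k)).bind (cons (.var 1) (cons (.msp (.var 4) (.var 0)) (cons (.var 3) .var)))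
        ((digit (k := k)).bind (cons (.var 3) (cons (.msp (.var 5) (.var 1)) (cons (.var 4) .var)))
          (.eq (.var 1) (.var 0)))))
    (.imp (.le _ _ _) (digit.bind_isB1 _ (digit.bind_isB1 _ (.eq _ _ _))))
    f (cons w (cons w' (cons b (cons y x))))
    (P := fun i => i ≤ A.len y → dig w (A.msp y i) b = dig w' (A.msp y i) b)
    (fun a => by simp [val_digit, comp_cons]) ?_ ?_ (le_refl (A.len y)) le_rfl
  · rwa [msp_of_le le_rfl] at this
  · intro h0
    have h1 := h 0 h0
    have h2 := h' 0 h0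
    rw [RecStep, msp_zero, half_zero] at h1 h2
    rw [msp_zero, h1, h2, hS]
  · intro i ih hi
    have h01 := A.zero_lt_one'
    have h1 := h _ hi
    have h2 := h' _ hi
    rw [RecStep] at h1 h2
    rw [h1, h2]
    rcases half_msp hi with ⟨h3, -⟩ | ⟨m, h3, h4⟩
    · have := zero_le i
      grind
    · obtain rfl : i = m := add_right_cancel h3
      rw [h4, ih (by grind)]

/-- Recursion on notation with truncation: for the arguments `b, y, x⃗` the value `R(y)` of the
function given by `R(y) = S(y, R(⌊y/2⌋), x⃗) ↾ |b|`, where `S(0, e, x⃗)` must not depend on `e`. -/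
def truncRec (S : Dfn k)
    (hS : ∀ (A : S12Model) (f : ℕ → A.Fn) (e e' : A.Num) (x : ℕ → A.Num),
      S.val A f (cons 0 (cons e x)) = S.val A f (cons 0 (cons e' x))) : Dfn k where
  graph := .bex (.smash (.var 2) (.var 1) * .smash 1 (.var 1))
    (.and (.ball (.len (.var 3)) S.recStep)
      (digit.bind (cons (.var 0) (cons (.var 3) (cons (.var 2) .var))) (.eq (.var 2) (.var 0))))
  bounds := []
  bound := .smash 1 (.var 0)
  isB1 := .bex _ (.and (.sball _ S.recStep_isB1) (digit.bind_isB1 _ (.eq _ _ _)))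
  graph_fnScoped := by
    refine .bex ?_ (.and (.ball trivial S.recStep_fnScoped)
      (bind_fnScoped (k := k) _ ?_ (by simp [Fm.FnScoped])))
    · simp
    · rintro (_ | _ | _ | i) <;> simp
  bounds_fnScoped := by simp
  bound_fnScoped := by simp
  total A f v := by
    obtain ⟨w, hw, h⟩ := exists_recStep hS A f (v 0) (v 1) fun i => v (i + 2)
    refine ⟨dig w (v 1) (v 0), ?_, (dig_lt _ _ _).le⟩
    have hv : v = cons (v 0) (cons (v 1) fun i => v (i + 2)) := by
      funext i
      rcases i with _ | _ | i <;> rfl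
    rw [hv]
    simp only [Fm.sat_bex, Fm.sat_and, Fm.sat_ball, sat_recStep]
    exact ⟨w, by simpa using hw, h, by simp [val_digit]⟩
  unique A f v y y' h h' := by
    have hv : v = cons (v 0) (cons (v 1) fun i => v (i + 2)) := by
      funext i
      rcases i with _ | _ | i <;> rfl
    rw [hv] at h h'
    simp only [Fm.sat_bex, Fm.sat_and, Fm.sat_ball, sat_recStep, sat_bind, val_digit] at h h'
    obtain ⟨w, -, h, h1⟩ := h
    obtain ⟨w', -, h', h1'⟩ := h'
    have := dig_unique_of_recStep hS h h'
    simp at h1 h1'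
    rw [h1, h1']
    exact this

theorem exists_val_truncRec
    (hS : ∀ (A : S12Model) (f : ℕ → A.Fn) (e e' : A.Num) (x : ℕ → A.Num),
      S.val A f (cons 0 (cons e x)) = S.val A f (cons 0 (cons e' x)))
    (A : S12Model) (f : ℕ → A.Fn) (b y : A.Num) (x : ℕ → A.Num) :
    ∃ w, (∀ j ≤ A.len y, S.RecStep A f w b y x j) ∧
      (truncRec S hS).val A f (cons b (cons y x)) = dig w y b := by
  have h := (truncRec S hS).sat_graph_val A f (cons b (cons y x))
  generalize (truncRec S hS).val A f (cons b (cons y x)) = u at h ⊢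
  simp only [truncRec, Fm.sat_bex, Fm.sat_and, Fm.sat_ball, sat_recStep, sat_bind, val_digit] at h
  obtain ⟨w, -, h, h1⟩ := h
  exact ⟨w, h, by simpa using h1⟩

end Dfn

/-! ### The standard model -/

theorem size_eq_half {x : ℕ} (hx : x ≠ 0) : Nat.size x = Nat.size (x / 2) + 1 := by
  have hpos : 0 < Nat.size x := Nat.size_pos.2 (Nat.pos_of_ne_zero hx)
  apply le_antisymm
  · rw [Nat.size_le, pow_succ]
    have := Nat.lt_size_self (x / 2)
    omega
  · have h1 : Nat.size (x / 2) ≤ Nat.size x - 1 := by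
      rw [Nat.size_le]
      have h2 := Nat.lt_size_self x
      obtain ⟨n, hn⟩ : ∃ n, Nat.size x = n + 1 := ⟨Nat.size x - 1, by omega⟩
      rw [hn, pow_succ] at h2
      rw [hn, Nat.add_sub_cancel]
      omega
    omega

theorem size_two_mul {x : ℕ} (hx : x ≠ 0) : Nat.size (2 * x) = Nat.size x + 1 := by
  rw [size_eq_half (by omega), Nat.mul_div_cancel_left x two_pos]

theorem size_two_mul_add_one (x : ℕ) : Nat.size (2 * x + 1) = Nat.size x + 1 := by
  rw [size_eq_half (by omega), show (2 * x + 1) / 2 = x by omega]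

theorem mspNat_zero (x : ℕ) : mspNat x 0 = 0 :=
  Nat.div_eq_of_lt (Nat.lt_size_self x)

theorem mspNat_of_le {x y : ℕ} (h : Nat.size x ≤ y) : mspNat x y = x := by
  rw [mspNat, Nat.sub_eq_zero_of_le h, pow_zero, Nat.div_one]

theorem mspNat_eq_half {x y : ℕ} (h : y < Nat.size x) : mspNat x y = mspNat x (y + 1) / 2 := by
  rw [mspNat, mspNat, Nat.div_div_eq_div_mul, ← pow_succ]
  congr 2
  omega

theorem mspNat_one {x : ℕ} (h : 1 ≤ x) : mspNat x 1 = 1 := by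
  rw [mspNat]
  have hpos : 0 < Nat.size x := Nat.size_pos.2 h
  have h1 : 2 ^ (Nat.size x - 1) ≤ x := Nat.lt_size.1 (by omega)
  have h2 := Nat.lt_size_self x
  obtain ⟨n, hn⟩ : ∃ n, Nat.size x = n + 1 := ⟨Nat.size x - 1, by omega⟩
  rw [hn, pow_succ] at h2
  rw [hn, Nat.add_sub_cancel] at h1 ⊢
  exact Nat.div_eq_of_lt_le (by omega) (by omega)

section

variable (f : ℕ → ℕ → ℕ) (v : ℕ → ℕ)

theorem Fm.holds_and (φ ψ : Fm) : (φ.and ψ).Holds f v ↔ φ.Holds f v ∧ ψ.Holds f v := by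
  simp [Fm.and, Fm.neg, Fm.Holds]

theorem Fm.holds_or (φ ψ : Fm) : (φ.or ψ).Holds f v ↔ φ.Holds f v ∨ ψ.Holds f v := by
  simp [Fm.or, Fm.neg, Fm.Holds, or_iff_not_imp_left]

theorem Fm.holds_iff (φ ψ : Fm) : (φ.iff ψ).Holds f v ↔ (φ.Holds f v ↔ ψ.Holds f v) := by
  simp [Fm.iff, Fm.holds_and, Fm.Holds, iff_iff_implies_and_implies]

theorem holds_basicAxioms {φ : Fm} (h : φ ∈ basicAxioms) : φ.Holds f v := by
  simp only [basicAxioms, List.mem_cons, List.not_mem_nil, or_false] at h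
  rcases h with rfl | rfl | rfl | rfl | rfl | rfl | rfl | rfl | rfl | rfl | rfl | rfl | rfl | rfl |
    rfl | rfl | rfl | rfl | rfl | rfl | rfl | rfl | rfl | rfl | rfl | rfl | rfl | rfl | rfl | rfl |
    rfl | rfl | rfl | rfl | rfl | rfl <;>
  simp only [Fm.Holds, Fm.neg, Fm.holds_and, Fm.holds_or, Fm.holds_iff,
    Tm.eval, one_add_one_eq_two]
  case _ => omega
  case _ => omega
  case _ => omega
  case _ => grind
  case _ => grind
  case _ => omega
  case _ => omega
  case _ => omega
  case _ => exact Nat.size_zero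
  case _ => exact fun h => ⟨size_two_mul h, size_two_mul_add_one _⟩
  case _ => exact Nat.size_one
  case _ => exact Nat.size_le_size
  case _ => exact Nat.size_pow
  case _ => rw [smashNat, Nat.size_zero, zero_mul, pow_zero]
  case _ =>
    intro h
    rw [smashNat, smashNat, smashNat, size_two_mul h, size_two_mul_add_one, Nat.size_one, one_mul,
      one_mul, pow_succ, mul_comm]
    exact ⟨rfl, rfl⟩
  case _ => rw [smashNat, smashNat, mul_comm]
  case _ =>
    intro h
    rw [smashNat, smashNat, h]
  case _ =>
    intro h
    rw [smashNat, smashNat, smashNat, h, add_mul, pow_add]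
  case _ => omega
  case _ => grind
  case _ => omega
  case _ => omega
  case _ => omega
  case _ => omega
  case _ => omega
  case _ => exact mul_zero _
  case _ => exact mul_add_one _ _
  case _ => exact mul_comm _ _
  case _ => exact mul_add _ _ _
  case _ => exact fun h => mul_le_mul_iff_right₀ h
  case _ => exact size_eq_half
  case _ => omega
  case _ => exact mspNat_zero _
  case _ => exact mspNat_one
  case _ => exact mspNat_eq_half
  case _ => exact mspNat_of_le

end

/-- The standard structure. -/
def stdModel : Model where
  Num := ℕ
  Fn := ℕ → ℕ
  zero := 0
  one := 1
  add := (· + ·)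
  mul := (· * ·)
  len := Nat.size
  half := (· / 2)
  smash := smashNat
  msp := mspNat
  ap g x := g x
  le := (· ≤ ·)

theorem val_stdModel (f : ℕ → ℕ → ℕ) (v : ℕ → ℕ) (t : Tm) : t.val stdModel f v = t.eval f v := by
  induction t with
  | var i => rfl
  | zero => rfl
  | one => rfl
  | add s t hs ht | mul s t hs ht | smash s t hs ht | msp s t hs ht =>
    simp only [Tm.val, Tm.eval, hs, ht]
    rfl
  | len t ht | half t ht | ap j t ht =>
    simp only [Tm.val, Tm.eval, ht]
    rfl

theorem sat_stdModel (f : ℕ → ℕ → ℕ) (v : ℕ → ℕ) (φ : Fm) :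
    φ.Sat stdModel f v ↔ φ.Holds f v := by
  induction φ generalizing f v with
  | bot => rfl
  | eq s t | le s t =>
    simp only [Fm.Sat, Fm.Holds, val_stdModel]
    rfl
  | imp φ ψ h h' => simp only [Fm.Sat, Fm.Holds, h, h']
  | all φ ih => exact forall_congr' fun a => ih f (cons a v)
  | allFn φ ih => exact forall_congr' fun g => ih (cons g f) v

theorem stdModel_satisfies : stdModel.Satisfies S12 := by
  rintro φ (hφ | ⟨ψ, -, rfl⟩) f v
  · exact (sat_stdModel f v φ).2 (holds_basicAxioms f v hφ)
  · simp only [pind, Fm.inst, Fm.sat_imp, Fm.sat_and, Fm.sat_all, Fm.sat_subst, comp_cons,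
      Tm.val_zero, Tm.val_half, Tm.val_var, cons_zero, cons_succ, id]
    rintro ⟨h0, h⟩ (a : ℕ)
    induction a using Nat.strongRec with
    | ind a ih =>
      rcases Nat.eq_zero_or_pos a with rfl | ha
      · exact h0
      · exact h a (ih (a / 2) (Nat.div_lt_self ha one_lt_two))

/-- The standard model of `S^1_2`. -/
def std : S12Model where
  toModel := stdModel
  fn := fun _ : ℕ => (0 : ℕ)
  sat := stdModel_satisfies

namespace Dfn

variable {k : ℕ}

/-- The defined function in the standard model. -/
noncomputable def stdVal (D : Dfn k) (f : ℕ → ℕ → ℕ) (v : ℕ → ℕ) : ℕ := D.val std f v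

/-- If the values of `F` at all prefixes of `y` have at most |b| bits, truncation does nothing, and
the digits of the code obey the recursion of `F` itself. -/
theorem stdVal_truncRec {S : Dfn k}
    (hS : ∀ (A : S12Model) (f : ℕ → A.Fn) (e e' : A.Num) (x : ℕ → A.Num),
      S.val A f (cons 0 (cons e x)) = S.val A f (cons 0 (cons e' x)))
    {f : ℕ → ℕ → ℕ} {b y : ℕ} {x : ℕ → ℕ} {F : ℕ → ℕ}
    (hF : ∀ s, F s = S.stdVal f (cons s (cons (F (s / 2)) x)))
    (hb : ∀ j ≤ Nat.size y, Nat.size (F (mspNat y j)) ≤ Nat.size b) :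
    (truncRec S hS).stdVal f (cons b (cons y x)) = F y := by
  obtain ⟨w, h, hval⟩ := exists_val_truncRec hS std f b y x
  have key : ∀ j : ℕ, j ≤ Nat.size y → (S12Model.dig (A := std) w (mspNat y j) b : ℕ) =
      F (mspNat y j) := by
    intro j hj
    have h1 : (S12Model.dig (A := std) w (mspNat y j) b : ℕ) = mspNat (S.stdVal f
      (cons (mspNat y j) (cons (S12Model.dig (A := std) w (mspNat y j / 2 : ℕ) b) x)))
        (Nat.size b) := h j hj
    induction j with
    | zero =>
      rw [mspNat_zero] at h1 ⊢
      rw [Nat.zero_div] at h1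
      have h2 := hF 0
      have h3 : S.stdVal f (cons 0 (cons (S12Model.dig (A := std) w (0 : ℕ) b) x)) =
          S.stdVal f (cons 0 (cons (F 0) x)) := hS std f _ _ x
      rw [Nat.zero_div] at h2
      refine h1.trans ?_
      rw [h3, ← h2]
      refine mspNat_of_le ?_
      have := hb 0 (Nat.zero_le _)
      rwa [mspNat_zero] at this
    | succ j ih =>
      have h2 := ih (by omega) (h j (by omega : j ≤ Nat.size y))
      rw [← mspNat_eq_half (by omega), h2, mspNat_eq_half (by omega : j < Nat.size y), ← hF] at h1
      rw [h1]
      exact mspNat_of_le (hb _ hj)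
  have h2 := key (Nat.size y) le_rfl
  rw [mspNat_of_le le_rfl] at h2
  exact hval.trans h2

end Dfn

/-- The sequence that starts with the entries of `a` and continues with `v`. -/
def appendSeq {α : Type} : (m : ℕ) → (Fin m → α) → (ℕ → α) → ℕ → α
  | 0, _, v => v
  | m + 1, a, v => cons (a 0) (appendSeq m (fun i => a i.succ) v)

theorem appendSeq_add {α : Type} (m : ℕ) (a : Fin m → α) (v : ℕ → α) (i : ℕ) :
    appendSeq m a v (i + m) = v i := by
  induction m with
  | zero => rfl
  | succ m ih => exact ih fun i => a i.succ

theorem appendSeq_fin {α : Type} (m : ℕ) (a : Fin m → α) (v : ℕ → α) (i : Fin m) :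
    appendSeq m a v i = a i := by
  induction m with
  | zero => exact i.elim0
  | succ m ih =>
    refine Fin.cases rfl (fun i => ?_) i
    exact ih (fun i => a i.succ) i

/-! ### Simultaneous composition and representation of functionals -/

namespace Dfn

variable {k : ℕ}

/-- The composition `D(E₁(x⃗), …, E_m(x⃗), x⃗)`. -/
def compFin : (m : ℕ) → (Fin m → Dfn k) → Dfn k → Dfn k
  | 0, _, D => D
  | m + 1, E, D => compFin m (fun i => E i.succ)
      -- `E 0` has to skip the `m` values that the remaining compositions put in front of the
      -- arguments.
      (D.comp ((E 0).subst id (fun i => .var (i + m)) (fun _ h => h) fun _ => Tm.fnScoped_var k _))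

theorem val_compFin (m : ℕ) (E : Fin m → Dfn k) (D : Dfn k) (A : S12Model) (f : ℕ → A.Fn)
    (v : ℕ → A.Num) :
    (compFin m E D).val A f v = D.val A f (appendSeq m (fun i => (E i).val A f v) v) := by
  induction m generalizing D with
  | zero => rfl
  | succ m ih =>
    rw [compFin, ih, val_comp, val_subst]
    simp only [Tm.val_var, appendSeq_add, id, appendSeq]

section

variable (D : Dfn k) (f : ℕ → ℕ → ℕ) (v : ℕ → ℕ)

theorem stdVal_ofTm (t : Tm) (ht : t.FnScoped k) : (ofTm t ht).stdVal f v = t.eval f v :=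
  (val_ofTm t ht std f v).trans (val_stdModel f v t)

theorem stdVal_subst {k' : ℕ} (ρ : ℕ → ℕ) (σ : ℕ → Tm) (hρ : ∀ j < k, ρ j < k')
    (hσ : ∀ i, (σ i).FnScoped k') :
    (D.subst ρ σ hρ hσ).stdVal f v = D.stdVal (fun j => f (ρ j)) fun i => (σ i).eval f v :=
  (val_subst D ρ σ hρ hσ std f v).trans
    (congrArg (D.stdVal fun j => f (ρ j)) (funext fun i => val_stdModel f v (σ i)))

theorem stdVal_comp (E : Dfn k) : (D.comp E).stdVal f v = D.stdVal f (cons (E.stdVal f v) v) :=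
  val_comp D E std f v

theorem stdVal_compFin (m : ℕ) (E : Fin m → Dfn k) :
    (compFin m E D).stdVal f v = D.stdVal f (appendSeq m (fun i => (E i).stdVal f v) v) :=
  val_compFin m E D std f v

theorem stdVal_cases :
    (v 0 = 0 → (cases (k := k)).stdVal f v = v 1) ∧
    (v 0 ≠ 0 → v 0 / 2 + v 0 / 2 = v 0 → (cases (k := k)).stdVal f v = v 2) ∧
    (v 0 ≠ 0 → v 0 / 2 + v 0 / 2 ≠ v 0 → (cases (k := k)).stdVal f v = v 3) :=
  val_cases std f v

end

/-- `D` defines `F` in the standard model. -/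
def Represents {l : ℕ} (D : Dfn k) (F : Functional k l) : Prop :=
  ∀ (f : ℕ → ℕ → ℕ) (v : ℕ → ℕ), D.stdVal f v = F (fun j => f j) fun i => v i

end Dfn

open Dfn

/-- An extension of `σ` to all natural numbers. -/
def extendFin {l l' : ℕ} (σ : Fin l → Fin l') (i : ℕ) : ℕ := if h : i < l then σ ⟨i, h⟩ else 0

theorem extendFin_val {l l' : ℕ} (σ : Fin l → Fin l') (i : Fin l) : extendFin σ i = σ i := by
  simp [extendFin]

theorem snoc_eq {l : ℕ} (v : ℕ → ℕ) :
    (fun i : Fin (l + 1) => v i) = Fin.snoc (α := fun _ => ℕ) (fun i : Fin l => v i) (v l) := by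
  funext i
  refine Fin.lastCases ?_ (fun i => ?_) i
  · simp
  · simp

/-- The recursion equations become one step function `S`, iterated with truncation to the length of
the maximum of `K`. The hypothesis |F| ≤ |K| is used only in ℕ, to see that the truncation is void.
-/
theorem exists_represents_limRec {k l : ℕ} {G : Functional k l} {H₁ H₂ : Functional k (l + 2)}
    {K F : Functional k (l + 1)} (hG : ∃ D : Dfn k, D.Represents G)
    (hH₁ : ∃ D : Dfn k, D.Represents H₁) (hH₂ : ∃ D : Dfn k, D.Represents H₂)
    (hK : ∃ D : Dfn k, D.Represents K)
    (h0 : ∀ f x, F f (Fin.snoc x 0) = G f x)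
    (h1 : ∀ f x y, 0 < y →
      F f (Fin.snoc x (2 * y)) = H₁ f (Fin.snoc (Fin.snoc x y) (F f (Fin.snoc x y))))
    (h2 : ∀ f x y,
      F f (Fin.snoc x (2 * y + 1)) = H₂ f (Fin.snoc (Fin.snoc x y) (F f (Fin.snoc x y))))
    (hF : ∀ f x y, Nat.size (F f (Fin.snoc x y)) ≤ Nat.size (K f (Fin.snoc x y))) :
    ∃ D : Dfn k, D.Represents F := by
  obtain ⟨G', hG⟩ := hG
  obtain ⟨H₁', hH₁⟩ := hH₁
  obtain ⟨H₂', hH₂⟩ := hH₂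
  obtain ⟨K', hK⟩ := hK
  -- The arguments of `S` are the current prefix, the previous value, and then the parameters; `τ`
  -- arranges them as x⃗, half of the prefix, previous value.
  let τ : ℕ → Tm := fun i => if i < l then .var (i + 2) else if i = l then .half (.var 0) else .var 1
  have hτ : ∀ i, (τ i).FnScoped k := fun i => by
    simp only [τ]
    split_ifs <;> simp
  -- In the order expected by `cases`: the number tested, then the results if it is zero, even or
  -- odd.
  let E : Fin 4 → Dfn k :=
    ![ofTm (.var 0) (Tm.fnScoped_var k 0),
      G'.subst id (fun i => .var (i + 2)) (fun _ h => h) fun _ => Tm.fnScoped_var k _,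
      H₁'.subst id τ (fun _ h => h) hτ, H₂'.subst id τ (fun _ h => h) hτ]
  let S : Dfn k := compFin 4 E cases
  have hS : ∀ (A : S12Model) (f : ℕ → A.Fn) (e e' : A.Num) (x : ℕ → A.Num),
      S.val A f (cons 0 (cons e x)) = S.val A f (cons 0 (cons e' x)) := by
    -- At 0 the case distinction selects `G'`, which does not see the previous value.
    have h : ∀ (A : S12Model) (f : ℕ → A.Fn) (e : A.Num) (x : ℕ → A.Num),
        S.val A f (cons 0 (cons e x)) = G'.val A f x := fun A f e x => by
      refine (val_compFin 4 _ _ A f _).trans (((val_cases A f _).1 ?_).trans ?_)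
      · simp [E, appendSeq]
      · simp [E, appendSeq]
    intro A f e e' x
    rw [h, h]
  let κ : ℕ → Tm := fun i => if i < l then .var (i + 1) else .var 0
  have hκ : ∀ i, (κ i).FnScoped k := fun i => by
    simp only [κ]
    split_ifs <;> simp
  -- All digits share one base, so one number has to bound `K` at every prefix.
  let M : Dfn k := (K'.subst id κ (fun _ h => h) hκ).max
  let R : Dfn k := (truncRec S hS).comp M
  have hvar : ∀ i, (cons (.var l) .var i : Tm).FnScoped k := by rintro (_ | i) <;> trivial
  -- The recursion variable is the last argument of `F`, with index `l`; `R` expects it in front.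
  refine ⟨R.subst id (cons (.var l) .var) (fun _ h => h) hvar, fun f v => ?_⟩
  let φ : Fin k → ℕ → ℕ := fun j => f j
  let x : Fin l → ℕ := fun i => v i
  have hτv : ∀ s e : ℕ, (fun i : Fin (l + 2) => (τ i).eval f (cons s (cons e v))) =
      Fin.snoc (α := fun _ => ℕ) (Fin.snoc (α := fun _ => ℕ) x (s / 2)) e := by
    intro s e
    funext i
    refine Fin.lastCases ?_ (fun i => ?_) i
    · simp [τ, Tm.eval]
    · refine Fin.lastCases ?_ (fun i => ?_) i
      · simp [τ, Tm.eval]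
      · simp [τ, Tm.eval, x]
  have hrec : ∀ s, F φ (Fin.snoc x s) =
      S.stdVal f (cons s (cons (F φ (Fin.snoc x (s / 2))) v)) := by
    intro s
    refine Eq.trans ?_ (stdVal_compFin _ f _ 4 E).symm
    have h4 := stdVal_cases (k := k) f (appendSeq 4 (fun i => (E i).stdVal f
        (cons s (cons (F φ (Fin.snoc x (s / 2))) v)))
      (cons s (cons (F φ (Fin.snoc x (s / 2))) v)))
    generalize (cases (k := k)).stdVal f _ = u at h4 ⊢
    simp only [E, appendSeq, cons_zero, Matrix.cons_val_zero,
      Matrix.cons_val_succ, stdVal_ofTm, stdVal_subst, Tm.eval, cons_succ,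
      id, hG _ _, hH₁ _ _, hH₂ _ _, hτv] at h4
    by_cases h5 : s = 0
    · rw [h5]
      refine Eq.trans ?_ (h4.1 h5).symm
      exact h0 φ x
    by_cases h6 : s / 2 + s / 2 = s
    · refine Eq.trans ?_ (h4.2.1 h5 h6).symm
      have h7 := h1 φ x (s / 2) (by omega)
      rwa [show 2 * (s / 2) = s by omega] at h7
    · refine Eq.trans ?_ (h4.2.2 h5 h6).symm
      have h7 := h2 φ x (s / 2)
      rwa [show 2 * (s / 2) + 1 = s by omega] at h7
  have hKval : ∀ s, (K'.subst id κ (fun _ h => h) hκ).stdVal f (cons s v) = K φ (Fin.snoc x s) := by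
    intro s
    rw [stdVal_subst, hK]
    refine congrArg _ (funext fun i => ?_)
    refine Fin.lastCases ?_ (fun i => ?_) i
    · simp [κ, Tm.eval]
    · simp [κ, Tm.eval, x]
  have hmax : ∀ j ≤ Nat.size (v l),
      Nat.size (F φ (Fin.snoc x (mspNat (v l) j))) ≤ Nat.size (M.stdVal f (cons (v l) v)) := by
    intro j hj
    refine (hF φ x _).trans (Nat.size_le_size ?_)
    rw [← hKval]
    exact val_le_val_max (K'.subst id κ (fun _ h => h) hκ) std f (v l) v hj
  have hR := stdVal_truncRec hS hrec hmax
  rw [snoc_eq]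
  refine Eq.trans ?_ hR
  rw [stdVal_subst, stdVal_comp]
  simp only [comp_cons, Tm.eval, id]

/-- Only values in the standard model are compared; provable totality and uniqueness are built into
`Dfn`. -/
theorem exists_represents {k l : ℕ} {F : Functional k l} (hF : IsBasicFeasible F) :
    ∃ D : Dfn k, D.Represents F := by
  induction hF with
  | zero => exact ⟨ofTm 0 (by simp), fun f v => stdVal_ofTm ..⟩
  | bit0 => exact ⟨ofTm ((1 + 1) * .var 0) (by simp), fun f v => stdVal_ofTm ..⟩
  | bit1 => exact ⟨ofTm ((1 + 1) * .var 0 + 1) (by simp), fun f v => stdVal_ofTm ..⟩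
  | proj i => exact ⟨ofTm (.var i) (by simp), fun f v => stdVal_ofTm ..⟩
  | smash => exact ⟨ofTm (.smash (.var 0) (.var 1)) (by simp), fun f v => stdVal_ofTm ..⟩
  | app => exact ⟨ofTm (.ap 0 (.var 0)) (by simp), fun f v => stdVal_ofTm ..⟩
  | expand ρ σ _ ih =>
    obtain ⟨D, hD⟩ := ih
    refine ⟨D.subst (extendFin ρ) (fun i => .var (extendFin σ i)) (fun j hj => ?_)
      (fun i => Tm.fnScoped_var _ (extendFin σ i)), fun f v => (stdVal_subst D ..).trans ?_⟩
    · rw [extendFin, dif_pos hj]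
      exact Fin.is_lt _
    · refine (hD _ _).trans ?_
      simp only [extendFin_val]
      rfl
  | @comp k l m H G _ _ ihH ihG =>
    obtain ⟨D, hD⟩ := ihH
    choose E hE using ihG
    refine ⟨compFin m E D, fun f v => (stdVal_compFin ..).trans ((hD _ _).trans ?_)⟩
    congr 1
    funext i
    refine Fin.addCases (fun i => ?_) (fun i => ?_) i
    · rw [Fin.append_left]
      exact (appendSeq_fin m _ v i).trans (hE i f v)
    · rw [Fin.append_right, Fin.val_natAdd, add_comm]
      exact appendSeq_add m _ v i
  | limRec _ _ _ _ h0 h1 h2 hF ihG ih₁ ih₂ ihK =>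
    exact exists_represents_limRec ihG ih₁ ih₂ ihK h0 h1 h2 hF

/-! ### Definability in `S^1_2` -/

theorem s12Proves_of_forall {k l : ℕ} {φ : Fm}
    (h : ∀ (A : S12Model) (f : ℕ → A.Fn) (v : ℕ → A.Num), φ.Sat A.toModel f v) :
    S12Proves (Fm.allFns k (Fm.alls l φ)) :=
  derives_of_forall_model fun A hA f v =>
    -- An assignment makes the function sort inhabited, so `f 0` can serve as the distinguished
    -- function.
    Fm.sat_allFns_of_forall (fun f v => Fm.sat_alls_of_forall f (h ⟨A, f 0, hA⟩ f) l v) k f v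

theorem Dfn.Represents.sigmaB1Definable {k l : ℕ} {D : Dfn k} {F : Functional k l}
    (hD : D.Represents F) : SigmaB1Definable F := by
  -- A `Dfn` may depend on all number variables; those beyond the `l` arguments are set to 0 so that
  -- formula and bounds are properly scoped.
  let τ : ℕ → Tm := fun i => if i < l then .var i else 0
  have hτ : ∀ i, (τ i).FnScoped k := fun i => by
    simp only [τ]
    split_ifs <;> simp
  have hτ' : ∀ i, (τ i).Scoped k l := fun i => by
    simp only [τ]
    split_ifs with h
    · exact h
    · trivial
  let E := D.subst id τ (fun _ h => h) hτ
  have hE : E.graph.Scoped k (l + 1) :=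
    D.graph_fnScoped.scoped_subst (fun _ h => h) (scoped_liftN hτ')
  have hlen : E.bounds.length = D.bounds.length := length_substs _ _ _
  refine ⟨E.graph, E.bounds, E.bound, E.isB1, hE, ?_, ?_, ?_, ?_⟩
  · refine scoped_bexs_substs D.bounds_fnScoped (fun _ h => h) hτ' ?_
    refine ⟨⟨⟨Nat.succ_pos _, (D.bound_fnScoped.scoped_subst (fun _ h => h)
      (scoped_liftsN hτ' _)).shift⟩, ?_, trivial⟩, trivial⟩
    change ((D.graph.subst id (liftN τ)).subst id _).Scoped _ _
    rw [Fm.subst_subst]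
    refine D.graph_fnScoped.scoped_subst (fun _ h => h) ?_
    rintro (_ | i)
    · exact Nat.succ_pos _
    · simp only [liftN, τ, cons_succ]
      split_ifs with h
      · change i + 1 + E.bounds.length < l + D.bounds.length + 1
        omega
      · trivial
  · refine s12Proves_of_forall fun A f v => ?_
    rw [Fm.sat_bexs]
    refine (E.boundedEx_val A f v).mono fun v' hv' h => ?_
    rw [Fm.sat_bex]
    refine ⟨_, h, ?_⟩
    simp only [Fm.sat_subst, comp_cons, Tm.val_var, cons_zero, id, Nat.add_right_comm _ 1,
      cons_succ, hv']
    exact E.sat_graph_val A f v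
  · refine s12Proves_of_forall fun A f v => ?_
    rw [Fm.sat_exUnique]
    exact ⟨_, E.sat_graph_val A f v, fun y hy => E.sat_graph_iff.1 hy⟩
  · intro f v
    rw [← sat_stdModel]
    refine (E.sat_graph_iff (A := std)).2 ?_
    refine Eq.trans ?_ (stdVal_subst D f v id τ _ hτ).symm
    refine Eq.trans ?_ (hD f _).symm
    congr 1
    funext i
    simp [τ, Tm.eval]

end BFF

/-- Every basic feasible functional is `Σ^b_1`-definable in `S^1_2`. -/
theorem theorem3 {k l : ℕ} (F : BFF.Functional k l) (hF : BFF.IsBasicFeasible F) :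
    BFF.SigmaB1Definable F := by
  obtain ⟨D, hD⟩ := BFF.exists_represents hF
  exact hD.sigmaB1Definable
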